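/- Let $\mathcal{P}=\mathcal{P}^{s+}_{3,5}$ be the cone of symmetric homogeneous polynomials $f\in\mathbb{R}[x,y,z]$ of degree $5$ with $f\ge 0$ on $\mathbb{R}_+^3$, $\mathbb{R}_+=[0,\infty)$. An element $f\in\mathcal{P}\setminus\{0\}$ is extremal if $g,h\in\mathcal{P}$, $g+h=f$ imply $g,h\in\mathbb{R}_+f$; then $\mathbb{R}_+f$ is an extremal ray. Say that $e$ is characterized in $\mathcal{P}$ by a condition if the elements of $\mathcal{P}$ satisfying it are exactly the polynomials $\alpha e$, $\alpha\ge0$. Notation. Put $S_n=x^n+y^n+z^n$, $S_{m,n}=x^my^n+y^mz^n+z^mx^n$, $T_{m,n}=S_{m,n}+S_{n,m}$, $U=xyz$, and $s_0=S_5-US_{1,1}$, $s_1=T_{4,1}-2US_{1,1}$, $s_2=T_{3,2}-2US_{1,1}$, $s_3=US_2-US_{1,1}$, $s_4=US_{1,1}$. Put $$\mu_L(t)=9(t-1)^2,\quad \mu_H(t)=(t+2)(7-t),\quad \mu_A(t)=\min\{\mu_L(t),\mu_H(t)\},\quad \mu_R(t)=2-t^2+t\sqrt{(t-1)(t+2)},$$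 $$\mu_B(t)=\tfrac12\Big(\mu_R(t)-\sqrt{\mu_R(t)^2-4}\Big),\quad \mu_Z(t,u)=\frac{(t+2)(7-t)-u}{(t+2)(5t+1)},\quad \omega(u)=u+\frac1u-2.$$ For $u>0$ let $\mathbf{e}^A_{t,u}=s_0+\sum_{i=1}^4p^A_i(t,u)s_i$ with $$p_1^A=\frac{u^2-(t+2)(5t^2+t+9)u+9(t-1)^2(t+2)^2}{(5t+1)(t+2)u},$$ $$p_2^A=\frac{-t^2u^3+(t-1)(7t^3-t^2+11t+1)u^2+(t+2)(17t^5-25t^4+199t^3-59t^2+76t+8)u+9(t-1)^4(t+2)^2(t^2-12t-1)}{(5t+1)^3(t+2)u},$$ $$\begin{aligned}p_3^A=\frac{1}{(t+2)^2(5t+1)^3u}\Big(&(2t^3+4t^2+5t+1)u^3-2(t+2)(7t^4+42t^3+37t^2+48t+10)u^2\\&+(t+2)^2(91t^5+125t^4+682t^3+182t^2+523t+125)u\\&-18(t-1)^2(t+2)^3(t^4+36t^3+34t^2+60t+13)\Big),\end{aligned}$$ $$p_4^A=\frac{(t-1)^3(6t^2+6t-12+u)^3}{(t+2)^2(5t+1)^3u},$$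 and let $\mathbf{e}^A_{t,0}=(5t+1)^2s_1+(t-1)^2(t^2-12t-1)s_2-2(t^4+36t^3+34t^2+60t+13)s_3+24(t-1)^4s_4$. With $w=\omega(u)$ let $$\begin{aligned}\mathbf{e}^B_{t,u}=s_0&-(2w+3)s_1+(w^2+2w+2)s_2\\&+\Big(-\frac{2t^3+4t^2+5t+1}{t^2(t+2)}w^2+\frac{2(4t^2+5t+3)}{t+2}w-\frac{3t^3-7t^2-12t-8}{t+2}\Big)s_3\\&+\frac{(t-1)^3(-w^2-2t^2w+t^2(t-2))}{t^2(t+2)}s_4.\end{aligned}$$ Finally let $$\mathbf{e}^C_t=s_0-(t+1)s_1+ts_2+(t+1)^2s_3,\qquad \mathbf{e}^D_t=s_1+(t^2-1)s_2-2(t+1)^2s_3,\qquad \mathbf{e}^D_\infty=s_2-2s_3,$$ $$\mathbf{e}^E_t=s_1-s_2-\frac{4t^2+5t+3}{t+2}s_3+\frac{(t-1)^3}{t+2}s_4,\qquad \mathbf{e}^E_\infty=s_4.$$ Theorem. The cone $\mathcal{P}$ is five dimensional. Its extremal elements are exactly the positive multiples of the polynomials $\mathbf{e}^A_{t,u}$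 ($0\le t\le7$, $0\le u\le\mu_A(t)$), $\mathbf{e}^B_{t,u}$ ($t\ge2$, $\mu_B(t)\le u\le1$), $\mathbf{e}^C_t$ ($0\le t\le2$), $\mathbf{e}^D_t$ ($t\in[0,\infty]$), $\mathbf{e}^E_t$ ($t\in[7,\infty]$) and $U(S_2-S_{1,1})$. Moreover, the following polynomials are characterized in $\mathcal{P}$ by the following conditions on $f\in\mathcal{P}$: 1. $\mathbf{e}^A_{t,u}$, for $0<t\le7$, $t\ne1$, $0\le u\le\mu_A(t)$, $u\ne\mu_H(t)$, by $f(t,1,1)=f(\mu_Z(t,u),1,1)=0$; 2. $\mathbf{e}^B_{t,u}$, for $t\ge2$, $\mu_B(t)\le u<1$, by $f(t,1,1)=f(0,u,1)=\frac{\partial f}{\partial y}(0,u,1)=0$; 3. $\mathbf{e}^C_t$, for $0<t\le2$, $t\ne1$, by $f(t,1,1)=f(1,1,1)=f(0,1,1)=0$; 4. $\mathbf{e}^D_t$, for $0<t<\infty$, $t\ne1$, by $f(t,1,1)=f(1,1,1)=f(0,0,1)=0$; 5. $\mathbf{e}^E_t$, for $7\le t<\infty$, by $f(t,1,1)=f(0,1,1)=f(0,0,1)=0$.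 -/

import Mathlib

noncomputable section

namespace SymQuintic

open MvPolynomial

/-- The symmetric homogeneous real polynomials of degree `d` in `n` variables. -/
def symForms (n d : ℕ) : Submodule ℝ (MvPolynomial (Fin n) ℝ) :=
  homogeneousSubmodule (Fin n) ℝ d ⊓
    Subalgebra.toSubmodule (symmetricSubalgebra (Fin n) ℝ)

/-- The PSD cone on `A` in `H`: the elements of `H` that are nonnegative at every point of `A`. -/
def psdCone {n : ℕ} (A : Set (Fin n → ℝ)) (H : Submodule ℝ (MvPolynomial (Fin n) ℝ)) :
    Set (MvPolynomial (Fin n) ℝ) :=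
  {f | f ∈ H ∧ ∀ a ∈ A, 0 ≤ eval a f}

/-- The cone of symmetric forms of degree `d` in `n` variables that are nonnegative on the
closed orthant `ℝ₊ⁿ`. -/
def symPsdCone (n d : ℕ) : Set (MvPolynomial (Fin n) ℝ) :=
  psdCone {a | ∀ i, 0 ≤ a i} (symForms n d)

/-- `f` is an extremal element of the cone `P`, i.e. `f` is a nonzero element of `P` and `ℝ₊ f`
is an extremal ray. -/
def IsExtremal {V : Type*} [AddCommGroup V] [Module ℝ V] (P : Set V) (f : V) : Prop :=
  f ∈ P ∧ f ≠ 0 ∧ ∀ g ∈ P, ∀ h ∈ P, g + h = f →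
    (∃ α : ℝ, 0 ≤ α ∧ g = α • f) ∧ (∃ β : ℝ, 0 ≤ β ∧ h = β • f)

/-- `f` is characterized in the cone `P` by the condition `cond`: the elements of `P` that satisfy
`cond` are exactly the nonnegative multiples of `f`. -/
def IsCharacterizedIn {V : Type*} [AddCommGroup V] [Module ℝ V] (P : Set V) (f : V)
    (cond : V → Prop) : Prop :=
  ∀ g ∈ P, cond g ↔ ∃ α : ℝ, 0 ≤ α ∧ g = α • f

/-- Ternary real polynomials; the variables are `X 0`, `X 1`, `X 2`. -/
abbrev Poly3 : Type := MvPolynomial (Fin 3) ℝ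

/-- `S_{m,n} = x^m y^n + y^m z^n + z^m x^n`. -/
def S2 (m n : ℕ) : Poly3 :=
  X 0 ^ m * X 1 ^ n + X 1 ^ m * X 2 ^ n + X 2 ^ m * X 0 ^ n

/-- `S_n = x^n + y^n + z^n`. -/
def S1 (n : ℕ) : Poly3 := X 0 ^ n + X 1 ^ n + X 2 ^ n

/-- `T_{m,n} = S_{m,n} + S_{n,m}`. -/
def T2 (m n : ℕ) : Poly3 := S2 m n + S2 n m

/-- `U = xyz`. -/
def U : Poly3 := X 0 * X 1 * X 2

def s0 : Poly3 := S1 5 - U * S2 1 1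
def s1 : Poly3 := T2 4 1 - 2 * U * S2 1 1
def s2 : Poly3 := T2 3 2 - 2 * U * S2 1 1
def s3 : Poly3 := U * S1 2 - U * S2 1 1
def s4 : Poly3 := U * S2 1 1

def muL (t : ℝ) : ℝ := 9 * (t - 1) ^ 2
def muH (t : ℝ) : ℝ := (t + 2) * (7 - t)
def muA (t : ℝ) : ℝ := min (muL t) (muH t)
def muR (t : ℝ) : ℝ := 2 - t ^ 2 + t * √((t - 1) * (t + 2))
def muB (t : ℝ) : ℝ := (1 / 2) * (muR t - √(muR t ^ 2 - 4))
def muZ (t u : ℝ) : ℝ := ((t + 2) * (7 - t) - u) / ((t + 2) * (5 * t + 1))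

def pA1 (t u : ℝ) : ℝ :=
  (u ^ 2 - (t + 2) * (5 * t ^ 2 + t + 9) * u + 9 * (t - 1) ^ 2 * (t + 2) ^ 2) /
    ((5 * t + 1) * (t + 2) * u)

def pA2 (t u : ℝ) : ℝ :=
  (-t ^ 2 * u ^ 3 + (t - 1) * (7 * t ^ 3 - t ^ 2 + 11 * t + 1) * u ^ 2
      + (t + 2) * (17 * t ^ 5 - 25 * t ^ 4 + 199 * t ^ 3 - 59 * t ^ 2 + 76 * t + 8) * u
      + 9 * (t - 1) ^ 4 * (t + 2) ^ 2 * (t ^ 2 - 12 * t - 1)) /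
    ((5 * t + 1) ^ 3 * (t + 2) * u)

def pA3 (t u : ℝ) : ℝ :=
  ((2 * t ^ 3 + 4 * t ^ 2 + 5 * t + 1) * u ^ 3
      - 2 * (t + 2) * (7 * t ^ 4 + 42 * t ^ 3 + 37 * t ^ 2 + 48 * t + 10) * u ^ 2
      + (t + 2) ^ 2
        * (91 * t ^ 5 + 125 * t ^ 4 + 682 * t ^ 3 + 182 * t ^ 2 + 523 * t + 125) * u
      - 18 * (t - 1) ^ 2 * (t + 2) ^ 3
        * (t ^ 4 + 36 * t ^ 3 + 34 * t ^ 2 + 60 * t + 13)) /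
    ((t + 2) ^ 2 * (5 * t + 1) ^ 3 * u)

def pA4 (t u : ℝ) : ℝ :=
  ((t - 1) ^ 3 * (6 * t ^ 2 + 6 * t - 12 + u) ^ 3) / ((t + 2) ^ 2 * (5 * t + 1) ^ 3 * u)

/-- The family `e^A_{t,u}`, with its separate definition at `u = 0`. -/
def eA (t u : ℝ) : Poly3 :=
  if u = 0 then
    (5 * t + 1) ^ 2 • s1 + ((t - 1) ^ 2 * (t ^ 2 - 12 * t - 1)) • s2
      - (2 * (t ^ 4 + 36 * t ^ 3 + 34 * t ^ 2 + 60 * t + 13)) • s3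
      + (24 * (t - 1) ^ 4) • s4
  else s0 + pA1 t u • s1 + pA2 t u • s2 + pA3 t u • s3 + pA4 t u • s4

def pB1 (_t w : ℝ) : ℝ := -2 * w - 3

def pB2 (_t w : ℝ) : ℝ := w ^ 2 + 2 * w + 2

def pB3 (t w : ℝ) : ℝ :=
  -((2 * t ^ 3 + 4 * t ^ 2 + 5 * t + 1) / (t ^ 2 * (t + 2))) * w ^ 2
    + (2 * (4 * t ^ 2 + 5 * t + 3) / (t + 2)) * w
    - (3 * t ^ 3 - 7 * t ^ 2 - 12 * t - 8) / (t + 2)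

def pB4 (t w : ℝ) : ℝ :=
  ((t - 1) ^ 3 * (-w ^ 2 - 2 * t ^ 2 * w + t ^ 2 * (t - 2))) / (t ^ 2 * (t + 2))

def omega (u : ℝ) : ℝ := u + 1 / u - 2

/-- The family `e^B_{t,u}`. -/
def eB (t u : ℝ) : Poly3 :=
  s0 + pB1 t (omega u) • s1 + pB2 t (omega u) • s2 + pB3 t (omega u) • s3
    + pB4 t (omega u) • s4

/-- The family `e^C_t`. -/
def eC (t : ℝ) : Poly3 := s0 - (t + 1) • s1 + t • s2 + (t + 1) ^ 2 • s3

/-- The family `e^D_t` for finite `t`. -/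
def eD (t : ℝ) : Poly3 := s1 + (t ^ 2 - 1) • s2 - (2 * (t + 1) ^ 2) • s3

/-- `e^D_∞`. -/
def eDInf : Poly3 := s2 - (2 : ℝ) • s3

/-- The family `e^E_t` for finite `t`. -/
def eE (t : ℝ) : Poly3 :=
  s1 - s2 - ((4 * t ^ 2 + 5 * t + 3) / (t + 2)) • s3 + ((t - 1) ^ 3 / (t + 2)) • s4

/-- `e^E_∞`. -/
def eEInf : Poly3 := s4

/-- The polynomials that generate the extremal rays. -/
def generators : Set Poly3 :=
  {f | ∃ t u : ℝ, 0 ≤ t ∧ t ≤ 7 ∧ 0 ≤ u ∧ u ≤ muA t ∧ f = eA t u} ∪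
  {f | ∃ t u : ℝ, 2 ≤ t ∧ muB t ≤ u ∧ u ≤ 1 ∧ f = eB t u} ∪
  {f | ∃ t : ℝ, 0 ≤ t ∧ t ≤ 2 ∧ f = eC t} ∪
  ({f | ∃ t : ℝ, 0 ≤ t ∧ f = eD t} ∪ {eDInf}) ∪
  ({f | ∃ t : ℝ, 7 ≤ t ∧ f = eE t} ∪ {eEInf}) ∪
  {U * (S1 2 - S2 1 1)}

end SymQuintic

end

/-!
A symmetric quintic form `f` is determined by its restriction `F(x) = f(x, 1, 1)`. The restrictions
are the polynomials of degree at most five on which a single linear functional vanishes, and `f` is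
nonnegative on the orthant as soon as it is nonnegative at the points `(x, 1, 1)` and `(0, u, 1)`.
On the edge, `f(0, u, 1)` is `u² (u + 1)` times a quadratic polynomial in `u + 1/u - 2`, so the cone
becomes a cone of univariate polynomials cut out by two nonnegativity conditions on the half-line.

Write an extremal `F` as `Z R`, where `Z` collects its roots on the half-line and `R` is positive
there. If `F` can be perturbed by a multiple of `Z`, respecting the linear constraint, and stay in
the cone on both sides, then the perturbation is proportional to `F`. Hence either `R` is constant
or linear and is determined up to scaling by the constraint, or the edge quadratic is the square of
a linear polynomial with a root on the half-line and `F` has one more double root, which determines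
it. Matching the positions of the roots with the parameters gives the families.
-/

noncomputable section

namespace SymQuintic

open Polynomial

/-! ### Extremal elements of convex cones -/

section Cone

variable {V W : Type*} [AddCommGroup V] [Module ℝ V] [AddCommGroup W] [Module ℝ W]
  {P : Set V} {f g : V}

lemma IsExtremal.smul (hP : ∀ c : ℝ, 0 < c → ∀ g ∈ P, c • g ∈ P) (hf : IsExtremal P f)
    {c : ℝ} (hc : 0 < c) : IsExtremal P (c • f) := by
  obtain ⟨hfP, hf0, hext⟩ := hf
  refine ⟨hP c hc f hfP, smul_ne_zero hc.ne' hf0, fun g hg h hh hgh => ?_⟩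
  have hc' : 0 < c⁻¹ := inv_pos.2 hc
  obtain ⟨⟨α, hα, hgα⟩, β, hβ, hhβ⟩ := hext _ (hP _ hc' g hg) _ (hP _ hc' h hh)
    (by rw [← smul_add, hgh, inv_smul_smul₀ hc.ne'])
  exact ⟨⟨α, hα, by rw [smul_comm, ← hgα, smul_inv_smul₀ hc.ne']⟩,
    β, hβ, by rw [smul_comm, ← hhβ, smul_inv_smul₀ hc.ne']⟩

lemma isExtremal_of_forall_sub_mem (hf : f ∈ P) (hf0 : f ≠ 0)
    (hpos : ∀ α : ℝ, α • f ∈ P → 0 ≤ α)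
    (hdom : ∀ g ∈ P, f - g ∈ P → ∃ α : ℝ, g = α • f) : IsExtremal P f := by
  have key : ∀ g ∈ P, ∀ h ∈ P, g + h = f → ∃ α : ℝ, 0 ≤ α ∧ g = α • f := by
    intro g hg h hh hgh
    obtain ⟨α, rfl⟩ := hdom g hg (by rwa [← hgh, add_sub_cancel_left])
    exact ⟨α, hpos α hg, rfl⟩
  exact ⟨hf, hf0, fun g hg h hh hgh =>
    ⟨key g hg h hh hgh, key h hh g hg ((add_comm h g).trans hgh)⟩⟩

lemma IsExtremal.exists_eq_smul_of_add_sub_mem (hP : ∀ c : ℝ, 0 < c → ∀ g ∈ P, c • g ∈ P)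
    (hf : IsExtremal P f) (hadd : f + g ∈ P) (hsub : f - g ∈ P) : ∃ α : ℝ, g = α • f := by
  have half : (0 : ℝ) < 1 / 2 := by norm_num
  obtain ⟨⟨α, -, hα⟩, -⟩ := hf.2.2 _ (hP _ half _ hadd) _ (hP _ half _ hsub) (by module)
  refine ⟨2 * α - 1, ?_⟩
  calc g = (2 : ℝ) • (1 / 2 : ℝ) • (f + g) - f := by module
    _ = (2 * α - 1) • f := by rw [hα]; module

lemma isExtremal_image_iff {H : Submodule ℝ V} (hPH : P ⊆ H) {φ : V →ₗ[ℝ] W}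
    (hφ : Set.InjOn φ H) (hf : f ∈ H) : IsExtremal (φ '' P) (φ f) ↔ IsExtremal P f := by
  have hsmul : ∀ g ∈ P, ∀ α : ℝ, φ g = α • φ f ↔ g = α • f := fun g hg α => by
    rw [← map_smul, hφ.eq_iff (hPH hg) (H.smul_mem α hf)]
  have hadd : ∀ g ∈ P, ∀ h ∈ P, φ g + φ h = φ f ↔ g + h = f := fun g hg h hh => by
    rw [← map_add, hφ.eq_iff (H.add_mem (hPH hg) (hPH hh)) hf]
  have h0 : φ f = 0 ↔ f = 0 := by rw [← map_zero φ, hφ.eq_iff hf H.zero_mem]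
  simp only [IsExtremal, hφ.mem_image_iff hPH hf, Set.forall_mem_image, ne_eq, h0]
  refine and_congr_right fun _ => and_congr_right fun _ => forall₂_congr fun g hg =>
    forall₂_congr fun h hh => ?_
  simp only [hadd g hg h hh, hsmul g hg, hsmul h hh]

end Cone

/-! ### Polynomials on the half-line -/

section HalfLine

open Filter Topology

variable {F G K P Q R Z Z' : ℝ[X]} {t : ℝ}

/-- The polynomial `F` is nonnegative on `[0, ∞)`. -/
def HalfLineNonneg (F : ℝ[X]) : Prop := ∀ x : ℝ, 0 ≤ x → 0 ≤ F.eval x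

/-- The polynomial `F` is positive on `[0, ∞)`. -/
def HalfLinePos (F : ℝ[X]) : Prop := ∀ x : ℝ, 0 ≤ x → 0 < F.eval x

lemma HalfLinePos.ne_zero (hF : HalfLinePos F) : F ≠ 0 := by
  rintro rfl
  simpa using hF 0 le_rfl

lemma halfLineNonneg_X : HalfLineNonneg X := fun x hx => by rwa [eval_X]

lemma halfLineNonneg_X_pow (n : ℕ) : HalfLineNonneg (X ^ n) := fun x hx => by
  rw [eval_pow, eval_X]
  exact pow_nonneg hx n

lemma halfLineNonneg_sq (P : ℝ[X]) : HalfLineNonneg (P ^ 2) := fun x _ => by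
  rw [eval_pow]
  positivity

lemma HalfLineNonneg.mul (hF : HalfLineNonneg F) (hG : HalfLineNonneg G) :
    HalfLineNonneg (F * G) := fun x hx => by
  rw [eval_mul]
  exact mul_nonneg (hF x hx) (hG x hx)

lemma HalfLineNonneg.smul (hF : HalfLineNonneg F) {c : ℝ} (hc : 0 ≤ c) :
    HalfLineNonneg (c • F) := fun x hx => by
  rw [eval_smul, smul_eq_mul]
  exact mul_nonneg hc (hF x hx)

lemma HalfLineNonneg.of_mul_left (hZ : HalfLineNonneg Z) (hZ0 : Z ≠ 0)
    (h : HalfLineNonneg (Z * P)) : HalfLineNonneg P := by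
  intro x hx
  have hlim : Tendsto P.eval (𝓝[>] x) (𝓝 (P.eval x)) :=
    P.continuous.continuousAt.mono_left nhdsWithin_le_nhds
  have hroots : ({y | IsRoot Z y} \ {x}).Finite := (finite_setOfPred_isRoot hZ0).sdiff
  refine ge_of_tendsto hlim ?_
  filter_upwards [self_mem_nhdsWithin,
    nhdsWithin_le_nhds (hroots.isClosed.isOpen_compl.mem_nhds fun hmem => hmem.2 rfl)]
    with y (hxy : x < y) hy
  have hy0 : 0 ≤ y := hx.trans hxy.le
  have hZy : Z.eval y ≠ 0 := fun h0 => hy ⟨h0, hxy.ne'⟩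
  exact nonneg_of_mul_nonneg_right (eval_mul (R := ℝ) ▸ h y hy0) ((hZ y hy0).lt_of_ne' hZy)

lemma HalfLineNonneg.X_dvd (hF : HalfLineNonneg F) (hR : HalfLineNonneg (X * R - F)) : X ∣ F := by
  refine X_dvd_iff.2 (F.coeff_zero_eq_eval_zero.trans (le_antisymm ?_ (hF 0 le_rfl)))
  simpa using hR 0 le_rfl

lemma HalfLineNonneg.sq_dvd_of_eval_eq_zero (hF : HalfLineNonneg F) (ht : 0 < t)
    (hroot : F.eval t = 0) : (X - C t) ^ 2 ∣ F := by
  have hmin : IsLocalMin F.eval t := by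
    filter_upwards [lt_mem_nhds ht] with x hx
    exact hroot.trans_le (hF x hx.le)
  have hderiv : F.derivative.eval t = 0 := by rw [← Polynomial.deriv, hmin.deriv_eq_zero]
  obtain ⟨G, rfl⟩ := dvd_iff_isRoot.2 hroot
  have hG : G.IsRoot t := by simpa using hderiv
  obtain ⟨H, rfl⟩ := dvd_iff_isRoot.2 hG
  exact ⟨H, by ring⟩

lemma HalfLineNonneg.natDegree_le (hK : HalfLineNonneg K) (hRK : HalfLineNonneg (R - K)) :
    K.natDegree ≤ R.natDegree := by
  by_contra! hlt
  have hK0 : K ≠ 0 := ne_zero_of_natDegree_gt hlt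
  have hO : K.eval =O[atTop] R.eval := by
    refine Asymptotics.IsBigO.of_bound 1 ?_
    filter_upwards [eventually_ge_atTop 0] with x hx
    have hle : K.eval x ≤ R.eval x := by simpa using hRK x hx
    rw [one_mul]
    exact abs_le_abs_of_nonneg (hK x hx) hle
  have ho := hO.trans_isLittleO (isLittleO_atTop_of_degree_lt R K (degree_lt_degree hlt))
  exact Asymptotics.isLittleO_irrefl'
    ((eventually_atTop_not_isRoot K hK0).mono fun x hx => norm_ne_zero_iff.2 hx).frequently ho

lemma HalfLineNonneg.coeff_nonneg (hF : HalfLineNonneg F) {n : ℕ} (hn : F.natDegree ≤ n) :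
    0 ≤ F.coeff n := by
  by_contra! hneg
  obtain rfl : F.natDegree = n := le_antisymm hn (le_natDegree_of_ne_zero hneg.ne)
  rcases F.natDegree.eq_zero_or_pos with hd | hd
  · rw [hd, coeff_zero_eq_eval_zero] at hneg
    exact hneg.not_ge (hF 0 le_rfl)
  · have hbot := F.tendsto_atBot_of_leadingCoeff_nonpos (natDegree_pos_iff_degree_pos.1 hd) hneg.le
    obtain ⟨x, hx, hx0⟩ := ((hbot.eventually_lt_atBot 0).and (eventually_ge_atTop 0)).exists
    exact hx.not_ge (hF x hx0)

/-- `Z` is nonzero, nonnegative on the half-line, and the ideal that it generates is convex for the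
pointwise order on the half-line. -/
structure ConvexDivisor (Z : ℝ[X]) : Prop where
  ne_zero : Z ≠ 0
  nonneg : HalfLineNonneg Z
  dvd : ∀ ⦃F R : ℝ[X]⦄, HalfLineNonneg F → HalfLineNonneg (Z * R - F) → Z ∣ F

lemma ConvexDivisor.mul (hZ : ConvexDivisor Z) (hZ' : ConvexDivisor Z') :
    ConvexDivisor (Z * Z') where
  ne_zero := mul_ne_zero hZ.ne_zero hZ'.ne_zero
  nonneg := hZ.nonneg.mul hZ'.nonneg
  dvd F R hF hR := by
    rw [mul_assoc] at hR
    obtain ⟨K, rfl⟩ := hZ.dvd hF hR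
    rw [← mul_sub] at hR
    exact mul_dvd_mul_left Z
      (hZ'.dvd (hZ.nonneg.of_mul_left hZ.ne_zero hF) (hZ.nonneg.of_mul_left hZ.ne_zero hR))

lemma ConvexDivisor.natDegree_le (hZ : ConvexDivisor Z) (hK : HalfLineNonneg (Z * K))
    (hRK : HalfLineNonneg (Z * R - Z * K)) : K.natDegree ≤ R.natDegree := by
  rw [← mul_sub] at hRK
  exact (hZ.nonneg.of_mul_left hZ.ne_zero hK).natDegree_le
    (hZ.nonneg.of_mul_left hZ.ne_zero hRK)

lemma convexDivisor_X : ConvexDivisor X :=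
  ⟨X_ne_zero, halfLineNonneg_X, fun _ _ hF hR => hF.X_dvd hR⟩

lemma convexDivisor_sq (ht : 0 ≤ t) : ConvexDivisor ((X - C t) ^ 2) := by
  rcases ht.eq_or_lt with rfl | ht
  · rw [C_0, sub_zero, sq]
    exact convexDivisor_X.mul convexDivisor_X
  · refine ⟨pow_ne_zero 2 (X_sub_C_ne_zero t), halfLineNonneg_sq _, fun F R hF hR =>
      hF.sq_dvd_of_eval_eq_zero ht (le_antisymm ?_ (hF t ht.le))⟩
    simpa using hR t ht.le

/-- The monic polynomial with a double root at each entry of `ts`. -/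
def doubleRoots (ts : List ℝ) : ℝ[X] := (ts.map fun t => (X - C t) ^ 2).prod

lemma doubleRoots_cons (t : ℝ) (ts : List ℝ) :
    doubleRoots (t :: ts) = (X - C t) ^ 2 * doubleRoots ts := by
  rw [doubleRoots, List.map_cons, List.prod_cons, doubleRoots]

lemma doubleRoots_nil : doubleRoots [] = 1 := by rw [doubleRoots, List.map_nil, List.prod_nil]

lemma monic_doubleRoots (ts : List ℝ) : (doubleRoots ts).Monic := by
  induction ts with
  | nil => exact doubleRoots_nil ▸ monic_one
  | cons t ts ih => exact doubleRoots_cons t ts ▸ ((monic_X_sub_C t).pow 2).mul ih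

lemma natDegree_doubleRoots (ts : List ℝ) : (doubleRoots ts).natDegree = 2 * ts.length := by
  induction ts with
  | nil => rw [doubleRoots_nil, natDegree_one, List.length_nil]
  | cons t ts ih =>
    rw [doubleRoots_cons, ((monic_X_sub_C t).pow 2).natDegree_mul (monic_doubleRoots ts), ih,
      natDegree_pow, natDegree_X_sub_C, List.length_cons]
    ring

lemma natDegree_X_pow_mul_doubleRoots_mul (ε : ℕ) (ts : List ℝ) (hR : R ≠ 0) :
    (X ^ ε * doubleRoots ts * R).natDegree = ε + 2 * ts.length + R.natDegree := by
  have hmonic : (X ^ ε * doubleRoots ts).Monic := (monic_X_pow ε).mul (monic_doubleRoots ts)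
  rw [hmonic.natDegree_mul' hR, (monic_X_pow ε).natDegree_mul (monic_doubleRoots ts),
    natDegree_X_pow, natDegree_doubleRoots]

lemma exists_eq_X_pow_mul_doubleRoots_mul (hF0 : F ≠ 0) (hF : HalfLineNonneg F) :
    ∃ (ε : ℕ) (ts : List ℝ) (R : ℝ[X]), ε ≤ 1 ∧ (∀ t ∈ ts, 0 ≤ t) ∧
      F = X ^ ε * doubleRoots ts * R ∧ HalfLinePos R := by
  induction hn : F.natDegree using Nat.strong_induction_on generalizing F with
  | _ n ih =>
  by_cases hroot : ∃ t : ℝ, 0 ≤ t ∧ F.eval t = 0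
  · obtain ⟨t, ht, hroot⟩ := hroot
    rcases ht.eq_or_lt with rfl | ht
    · obtain ⟨G, rfl⟩ := X_dvd_iff.2 (F.coeff_zero_eq_eval_zero.trans hroot)
      have hG0 : G ≠ 0 := right_ne_zero_of_mul hF0
      rw [natDegree_X_mul hG0] at hn
      obtain ⟨ε, ts, R, hε, hts, rfl, hR⟩ :=
        ih G.natDegree (by omega) hG0 (halfLineNonneg_X.of_mul_left X_ne_zero hF) rfl
      interval_cases ε
      · exact ⟨1, ts, R, le_rfl, hts, by ring, hR⟩
      · refine ⟨0, 0 :: ts, R, zero_le_one, List.forall_mem_cons.2 ⟨le_rfl, hts⟩, ?_, hR⟩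
        rw [doubleRoots_cons, C_0]
        ring
    · obtain ⟨G, rfl⟩ := hF.sq_dvd_of_eval_eq_zero ht hroot
      have hG0 : G ≠ 0 := right_ne_zero_of_mul hF0
      rw [natDegree_mul (left_ne_zero_of_mul hF0) hG0, natDegree_pow, natDegree_X_sub_C] at hn
      obtain ⟨ε, ts, R, hε, hts, rfl, hR⟩ := ih G.natDegree (by omega) hG0
        ((halfLineNonneg_sq _).of_mul_left (left_ne_zero_of_mul hF0) hF) rfl
      refine ⟨ε, t :: ts, R, hε, List.forall_mem_cons.2 ⟨ht.le, hts⟩, ?_, hR⟩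
      rw [doubleRoots_cons]
      ring
  · push Not at hroot
    exact ⟨0, [], F, zero_le_one, by simp, by simp [doubleRoots_nil],
      fun x hx => (hF x hx).lt_of_ne' (hroot x hx)⟩

lemma HalfLinePos.exists_abs_eval_le_mul (hR : HalfLinePos R) (hd : K.natDegree ≤ R.natDegree) :
    ∃ M : ℝ, 0 < M ∧ ∀ x : ℝ, 0 ≤ x → |K.eval x| ≤ M * R.eval x := by
  have hdeg : K.degree ≤ R.degree := by
    rw [degree_eq_natDegree hR.ne_zero]
    exact degree_le_of_natDegree_le hd
  obtain ⟨A, hA⟩ := (isBigO_atTop_of_degree_le K R hdeg).bound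
  obtain ⟨N, hN⟩ := eventually_atTop.1 hA
  have hcont : ContinuousOn (fun x => K.eval x / R.eval x) (Set.Icc 0 N) :=
    K.continuous.continuousOn.div R.continuous.continuousOn fun x hx => (hR x hx.1).ne'
  obtain ⟨B, hB⟩ := isCompact_Icc.exists_bound_of_continuousOn hcont
  refine ⟨max 1 (max A B), one_pos.trans_le (le_max_left _ _), fun x hx => ?_⟩
  have hRx := hR x hx
  rcases le_total N x with hNx | hxN
  · have hle := hN x hNx
    rw [Real.norm_eq_abs, Real.norm_eq_abs, abs_of_pos hRx] at hle
    exact hle.trans (mul_le_mul_of_nonneg_right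
      ((le_max_left _ _).trans (le_max_right _ _)) hRx.le)
  · have hle := hB x ⟨hx, hxN⟩
    rw [Real.norm_eq_abs, abs_div, abs_of_pos hRx, div_le_iff₀ hRx] at hle
    exact hle.trans (mul_le_mul_of_nonneg_right
      ((le_max_right _ _).trans (le_max_right _ _)) hRx.le)

lemma HalfLinePos.exists_abs_eval_le_X_mul (hR : HalfLinePos R)
    (hd : Q.natDegree ≤ (X * R).natDegree) (h0 : Q.eval 0 = 0) :
    ∃ M : ℝ, 0 < M ∧ ∀ x : ℝ, 0 ≤ x → |Q.eval x| ≤ M * (X * R).eval x := by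
  obtain ⟨K, rfl⟩ := X_dvd_iff.2 (Q.coeff_zero_eq_eval_zero.trans h0)
  have hKR : K.natDegree ≤ R.natDegree := by
    by_cases hK : K = 0
    · simp [hK]
    · rwa [natDegree_X_mul hK, natDegree_X_mul hR.ne_zero, Nat.succ_le_succ_iff] at hd
  obtain ⟨M, hM, hle⟩ := hR.exists_abs_eval_le_mul hKR
  refine ⟨M, hM, fun x hx => ?_⟩
  rw [eval_mul, eval_mul, eval_X, abs_mul, abs_of_nonneg hx, mul_left_comm]
  exact mul_le_mul_of_nonneg_left (hle x hx) hx

lemma exists_abs_eval_le_mul_of_natDegree_le_two (hP : HalfLineNonneg P)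
    (hd : P.natDegree ≤ 2) (hsq : ¬∃ a w₀ : ℝ, 0 < a ∧ 0 ≤ w₀ ∧ P = C a * (X - C w₀) ^ 2)
    (hQ : Q.natDegree ≤ P.natDegree) (h0 : P.eval 0 = 0 → Q.eval 0 = 0) :
    ∃ M : ℝ, 0 < M ∧ ∀ x : ℝ, 0 ≤ x → |Q.eval x| ≤ M * P.eval x := by
  by_cases hP0 : P = 0
  · subst hP0
    have hQ0 : Q = 0 := by
      rw [eq_C_of_natDegree_le_zero hQ, coeff_zero_eq_eval_zero, h0 eval_zero, C_0]
    exact ⟨1, one_pos, fun x _ => by simp [hQ0]⟩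
  obtain ⟨ε, ts, R, hε, hts, rfl, hR⟩ := exists_eq_X_pow_mul_doubleRoots_mul hP0 hP
  rcases ts with _ | ⟨t, ts⟩
  · simp only [doubleRoots_nil, mul_one] at *
    interval_cases ε
    · rw [pow_zero, one_mul] at hQ ⊢
      exact hR.exists_abs_eval_le_mul hQ
    · rw [pow_one] at h0 hQ ⊢
      exact hR.exists_abs_eval_le_X_mul hQ (h0 (by simp))
  · refine absurd ?_ hsq
    have hfac : X ^ ε * doubleRoots (t :: ts) * R =
        (X - C t) ^ 2 * (X ^ ε * doubleRoots ts * R) := by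
      rw [doubleRoots_cons]
      ring
    have hW0 : X ^ ε * doubleRoots ts * R ≠ 0 := right_ne_zero_of_mul (hfac ▸ hP0)
    rw [hfac, natDegree_mul (pow_ne_zero 2 (X_sub_C_ne_zero t)) hW0, natDegree_pow,
      natDegree_X_sub_C] at hd
    have hW := eq_C_of_natDegree_le_zero (p := X ^ ε * doubleRoots ts * R) (by omega)
    rw [hfac] at hP ⊢
    have hWnonneg := (halfLineNonneg_sq _).of_mul_left (pow_ne_zero 2 (X_sub_C_ne_zero t)) hP
    rw [hW] at hWnonneg hW0 ⊢
    exact ⟨_, t, by simpa using (hWnonneg 0 le_rfl).lt_of_ne' (by simpa using hW0),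
      hts t List.mem_cons_self, mul_comm _ _⟩

end HalfLine

/-! ### The cone of restrictions to the line through `(0, 1, 1)` and `(1, 1, 1)` -/

section DiagCone

variable {F G K R Z : ℝ[X]}

/-- The polynomial of degree at most five with the given coefficients. -/
def quintic (a₅ a₄ a₃ a₂ a₁ a₀ : ℝ) : ℝ[X] :=
  C a₅ * X ^ 5 + C a₄ * X ^ 4 + C a₃ * X ^ 3 + C a₂ * X ^ 2 + C a₁ * X + C a₀

/-- The quadratic polynomial `g` with `f(0, u, 1) = u² (u + 1) g(u + 1/u - 2)` if `F` is the
restriction `f(x, 1, 1)` of the symmetric quintic form `f`. -/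
def edge : ℝ[X] →ₗ[ℝ] ℝ[X] where
  toFun F := C (F.coeff 5) * X ^ 2 + C (3 * F.coeff 5 + F.coeff 4 / 2) * X + C (F.coeff 0 / 2)
  map_add' F G := Polynomial.funext fun w => by simp; ring
  map_smul' c F := Polynomial.funext fun w => by simp; ring

/-- The functional whose kernel, among the polynomials of degree at most five, consists of the
restrictions `f(x, 1, 1)` of symmetric quintic forms `f`. -/
def balance : ℝ[X] →ₗ[ℝ] ℝ := (3 : ℝ) • (leval 1 ∘ₗ derivative) - (5 : ℝ) • leval 1

/-- The polynomials that are restrictions `f(x, 1, 1)` of the symmetric quintic forms `f` in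
`symPsdCone 3 5`. -/
structure MemDiagCone (F : ℝ[X]) : Prop where
  natDegree_le : F.natDegree ≤ 5
  balance_eq_zero : balance F = 0
  nonneg : HalfLineNonneg F
  edge_nonneg : HalfLineNonneg (edge F)

/-- The set of polynomials `F` with `MemDiagCone F`. -/
def diagCone : Set ℝ[X] := {F | MemDiagCone F}

section Quintic

variable (a₅ a₄ a₃ a₂ a₁ a₀ : ℝ)

lemma eval_quintic (x : ℝ) : (quintic a₅ a₄ a₃ a₂ a₁ a₀).eval x =
    a₅ * x ^ 5 + a₄ * x ^ 4 + a₃ * x ^ 3 + a₂ * x ^ 2 + a₁ * x + a₀ := by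
  simp [quintic]

lemma natDegree_quintic_le : (quintic a₅ a₄ a₃ a₂ a₁ a₀).natDegree ≤ 5 := by
  rw [quintic]
  compute_degree

lemma coeff_quintic_five : (quintic a₅ a₄ a₃ a₂ a₁ a₀).coeff 5 = a₅ := by
  simp [quintic]

lemma coeff_quintic_four : (quintic a₅ a₄ a₃ a₂ a₁ a₀).coeff 4 = a₄ := by
  simp [quintic]

lemma coeff_quintic_zero : (quintic a₅ a₄ a₃ a₂ a₁ a₀).coeff 0 = a₀ := by
  simp [quintic]

lemma edge_quintic : edge (quintic a₅ a₄ a₃ a₂ a₁ a₀) =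
    C a₅ * X ^ 2 + C (3 * a₅ + a₄ / 2) * X + C (a₀ / 2) := by
  simp [edge, coeff_quintic_five, coeff_quintic_four, coeff_quintic_zero]

lemma balance_quintic : balance (quintic a₅ a₄ a₃ a₂ a₁ a₀) =
    10 * a₅ + 7 * a₄ + 4 * a₃ + a₂ - 2 * a₁ - 5 * a₀ := by
  simp [balance, quintic]
  ring

lemma quintic_inj {b₅ b₄ b₃ b₂ b₁ b₀ : ℝ} :
    quintic a₅ a₄ a₃ a₂ a₁ a₀ = quintic b₅ b₄ b₃ b₂ b₁ b₀ ↔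
      a₅ = b₅ ∧ a₄ = b₄ ∧ a₃ = b₃ ∧ a₂ = b₂ ∧ a₁ = b₁ ∧ a₀ = b₀ := by
  refine ⟨fun h => ?_, fun ⟨h5, h4, h3, h2, h1, h0⟩ => by rw [h5, h4, h3, h2, h1, h0]⟩
  have hcoeff := fun n => congrArg (fun F : ℝ[X] => F.coeff n) h
  simp only [quintic, coeff_add, coeff_C_mul, coeff_X_pow, coeff_X, coeff_C] at hcoeff
  exact ⟨by simpa using hcoeff 5, by simpa using hcoeff 4, by simpa using hcoeff 3,
    by simpa using hcoeff 2, by simpa using hcoeff 1, by simpa using hcoeff 0⟩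

end Quintic

lemma eq_quintic (hF : F.natDegree ≤ 5) : F =
    quintic (F.coeff 5) (F.coeff 4) (F.coeff 3) (F.coeff 2) (F.coeff 1) (F.coeff 0) := by
  conv_lhs => rw [F.as_sum_range_C_mul_X_pow' (Nat.lt_succ_of_le hF)]
  simp only [Finset.sum_range_succ, Finset.sum_range_zero, pow_zero, pow_one, mul_one]
  rw [quintic]
  ring

lemma eval_edge (F : ℝ[X]) (w : ℝ) : (edge F).eval w =
    F.coeff 5 * w ^ 2 + (3 * F.coeff 5 + F.coeff 4 / 2) * w + F.coeff 0 / 2 := by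
  simp [edge]

lemma natDegree_edge_le (F : ℝ[X]) : (edge F).natDegree ≤ 2 := natDegree_quadratic_le

lemma balance_mul (Z K : ℝ[X]) : balance (Z * K) =
    3 * (Z.derivative.eval 1 * K.eval 1 + Z.eval 1 * K.derivative.eval 1)
      - 5 * (Z.eval 1 * K.eval 1) := by
  simp [balance, derivative_mul]

lemma balance_sq_mul (P : ℝ[X]) : balance ((X - C 1) ^ 2 * P) = 0 := by
  simp [balance_mul, derivative_pow]

lemma smul_mem_diagCone {c : ℝ} (hc : 0 < c) (hF : F ∈ diagCone) : c • F ∈ diagCone where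
  natDegree_le := (natDegree_smul_le c F).trans hF.natDegree_le
  balance_eq_zero := by rw [map_smul, hF.balance_eq_zero, smul_zero]
  nonneg := hF.nonneg.smul hc.le
  edge_nonneg := by
    rw [map_smul]
    exact hF.edge_nonneg.smul hc.le

lemma nonneg_of_smul_mem_diagCone (hF : F ∈ diagCone) (hF0 : F ≠ 0) {α : ℝ}
    (h : α • F ∈ diagCone) : 0 ≤ α := by
  obtain ⟨x, hx, hx0⟩ := ((eventually_atTop_not_isRoot F hF0).and
    (Filter.eventually_ge_atTop 0)).exists
  have hαx := h.nonneg x hx0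
  rw [eval_smul, smul_eq_mul] at hαx
  exact nonneg_of_mul_nonneg_left hαx ((hF.nonneg x hx0).lt_of_ne' hx)

lemma isExtremal_mul_of_convexDivisor (hZ : ConvexDivisor Z) (hR : R ≠ 0)
    (hF : Z * R ∈ diagCone)
    (hprop : ∀ K : ℝ[X], K.natDegree ≤ R.natDegree → balance (Z * K) = 0 →
      ∃ α : ℝ, K = α • R) : IsExtremal diagCone (Z * R) := by
  have hF0 : Z * R ≠ 0 := mul_ne_zero hZ.ne_zero hR
  refine isExtremal_of_forall_sub_mem hF hF0 (fun α => nonneg_of_smul_mem_diagCone hF hF0)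
    fun G hG hsub => ?_
  obtain ⟨K, rfl⟩ := hZ.dvd hG.nonneg hsub.nonneg
  obtain ⟨α, rfl⟩ := hprop K (hZ.natDegree_le hG.nonneg hsub.nonneg) hG.balance_eq_zero
  exact ⟨α, mul_smul_comm α Z R⟩

lemma ConvexDivisor.isExtremal (hZ : ConvexDivisor Z) (hF : Z ∈ diagCone) :
    IsExtremal diagCone Z := by
  rw [← mul_one Z] at hF ⊢
  refine isExtremal_mul_of_convexDivisor hZ one_ne_zero hF fun K hK _ => ⟨K.coeff 0, ?_⟩
  rw [eq_C_of_natDegree_le_zero (hK.trans_eq natDegree_one), coeff_C_zero, smul_eq_C_mul, mul_one]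

lemma exists_eq_smul_of_balance_eq_zero (hZ : Z.eval 1 ≠ 0) (hR0 : R ≠ 0)
    (hR : R.natDegree ≤ 1) (hK : K.natDegree ≤ 1) (hbR : balance (Z * R) = 0)
    (hbK : balance (Z * K) = 0) : ∃ α : ℝ, K = α • R := by
  -- If `D(1) = 0`, then `balance (Z * D) = 3 Z(1) D'(1)`.
  have eq_zero : ∀ D : ℝ[X], D.natDegree ≤ 1 → balance (Z * D) = 0 → D.eval 1 = 0 → D = 0 := by
    intro D hD hb h1
    have hD1 : D.derivative.eval 1 = 0 := by
      rw [balance_mul, h1] at hb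
      simpa [hZ] using hb
    rw [eq_X_add_C_of_natDegree_le_one hD] at h1 hD1 ⊢
    simp_all
  have hR1 : R.eval 1 ≠ 0 := fun h => hR0 (eq_zero R hR hbR h)
  refine ⟨K.eval 1 / R.eval 1, sub_eq_zero.1 (eq_zero _ ?_ ?_ ?_)⟩
  · exact (natDegree_sub_le_of_le hK ((natDegree_smul_le _ _).trans hR)).trans_eq (max_self 1)
  · rw [mul_sub, mul_smul_comm, map_sub, map_smul, hbR, hbK, smul_zero, sub_zero]
  · rw [eval_sub, eval_smul, smul_eq_mul, div_mul_cancel₀ _ hR1, sub_self]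

lemma isExtremal_mul_of_natDegree_le_one (hZ : ConvexDivisor Z) (hZ1 : Z.eval 1 ≠ 0)
    (hR0 : R ≠ 0) (hR : R.natDegree ≤ 1) (hF : Z * R ∈ diagCone) :
    IsExtremal diagCone (Z * R) :=
  isExtremal_mul_of_convexDivisor hZ hR0 hF fun _ hK hb =>
    exists_eq_smul_of_balance_eq_zero hZ1 hR0 hR (hK.trans hR) hF.balance_eq_zero hb

end DiagCone

/-! ### The extremal restrictions -/

section Families

variable {t z a c : ℝ}

lemma linear_ne_zero (hac : 0 < a + c) : (C a * X + C c : ℝ[X]) ≠ 0 := fun h => by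
  have h1 := congrArg (eval 1) h
  simp only [eval_add, eval_mul, eval_C, eval_X, mul_one, eval_zero] at h1
  exact hac.ne' h1

lemma halfLineNonneg_linear (ha : 0 ≤ a) (hc : 0 ≤ c) :
    HalfLineNonneg (C a * X + C c) := fun x hx => by
  simp only [eval_add, eval_mul, eval_C, eval_X]
  positivity

lemma sq_one_mem_diagCone : (X - C 1) ^ 2 ∈ diagCone := by
  have hq : (X - C 1 : ℝ[X]) ^ 2 = quintic 0 0 0 1 (-2) 1 :=
    Polynomial.funext fun x => by simp [eval_quintic]; ring
  refine ⟨hq ▸ natDegree_quintic_le .., ?_, halfLineNonneg_sq _, fun w _ => ?_⟩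
  · simpa using balance_sq_mul 1
  · rw [hq, edge_quintic]
    simp

lemma X_mul_sq_one_mem_diagCone : X * (X - C 1) ^ 2 ∈ diagCone := by
  have hq : (X * (X - C 1) ^ 2 : ℝ[X]) = quintic 0 0 1 (-2) 1 0 :=
    Polynomial.funext fun x => by simp [eval_quintic]; ring
  refine ⟨hq ▸ natDegree_quintic_le .., ?_, halfLineNonneg_X.mul (halfLineNonneg_sq _),
    fun w _ => ?_⟩
  · rw [mul_comm, balance_sq_mul]
  · rw [hq, edge_quintic]
    simp

lemma X_mul_linear_mem_diagCone : X * (C 2 * X + C 1) ∈ diagCone := by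
  have hq : (X * (C 2 * X + C 1) : ℝ[X]) = quintic 0 0 0 2 1 0 :=
    Polynomial.funext fun x => by simp [eval_quintic]; ring
  refine ⟨hq ▸ natDegree_quintic_le .., ?_,
    halfLineNonneg_X.mul (halfLineNonneg_linear zero_le_two zero_le_one), fun w _ => ?_⟩
  · rw [hq, balance_quintic]
    norm_num
  · rw [hq, edge_quintic]
    simp

lemma isExtremal_sq_one : IsExtremal diagCone ((X - C 1) ^ 2) :=
  (convexDivisor_sq zero_le_one).isExtremal sq_one_mem_diagCone

lemma isExtremal_X_mul_sq_one : IsExtremal diagCone (X * (X - C 1) ^ 2) :=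
  (convexDivisor_X.mul (convexDivisor_sq zero_le_one)).isExtremal X_mul_sq_one_mem_diagCone

lemma isExtremal_X_mul_linear : IsExtremal diagCone (X * (C 2 * X + C 1)) :=
  isExtremal_mul_of_natDegree_le_one convexDivisor_X (by simp) (linear_ne_zero (by norm_num))
    natDegree_linear_le X_mul_linear_mem_diagCone

/-- The quartic with a root at `0`, a double root at `t` and the cofactor `a X + c`. -/
def rootAndZero (t a c : ℝ) : ℝ[X] := X * (X - C t) ^ 2 * (C a * X + C c)

lemma rootAndZero_eq_quintic (t a c : ℝ) : rootAndZero t a c =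
    quintic 0 a (c - 2 * t * a) (t ^ 2 * a - 2 * t * c) (t ^ 2 * c) 0 :=
  Polynomial.funext fun x => by
    simp only [rootAndZero, eval_quintic, eval_mul, eval_pow, eval_sub, eval_add, eval_X, eval_C]
    ring

lemma balance_rootAndZero (t a c : ℝ) : balance (rootAndZero t a c) =
    (1 - t) * ((2 * t + 4) * (a + c) - 3 * (t - 1) * a) := by
  rw [rootAndZero_eq_quintic, balance_quintic]
  ring

lemma rootAndZero_mem_diagCone (ha : 0 ≤ a) (hc : 0 ≤ c) (hb : balance (rootAndZero t a c) = 0) :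
    rootAndZero t a c ∈ diagCone := by
  refine ⟨rootAndZero_eq_quintic t a c ▸ natDegree_quintic_le .., hb,
    (halfLineNonneg_X.mul (halfLineNonneg_sq _)).mul (halfLineNonneg_linear ha hc),
    fun w hw => ?_⟩
  rw [rootAndZero_eq_quintic, edge_quintic]
  simp only [eval_add, eval_mul, eval_pow, eval_X, eval_C]
  positivity

lemma isExtremal_rootAndZero (ht : 0 ≤ t) (ht1 : t ≠ 1) (ha : 0 ≤ a) (hc : 0 ≤ c)
    (hac : 0 < a + c) (hb : balance (rootAndZero t a c) = 0) :
    IsExtremal diagCone (rootAndZero t a c) :=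
  isExtremal_mul_of_natDegree_le_one (convexDivisor_X.mul (convexDivisor_sq ht))
    (by simpa using sub_ne_zero.2 ht1.symm) (linear_ne_zero hac) natDegree_linear_le
    (rootAndZero_mem_diagCone ha hc hb)

/-- The quintic with double roots at `t` and `z` and the cofactor `a X + c`. -/
def twoRoots (t z a c : ℝ) : ℝ[X] := (X - C t) ^ 2 * (X - C z) ^ 2 * (C a * X + C c)

lemma twoRoots_eq_quintic (t z a c : ℝ) : twoRoots t z a c =
    quintic a (c - 2 * (t + z) * a) ((t ^ 2 + 4 * t * z + z ^ 2) * a - 2 * (t + z) * c)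
      ((t ^ 2 + 4 * t * z + z ^ 2) * c - 2 * t * z * (t + z) * a)
      (t ^ 2 * z ^ 2 * a - 2 * t * z * (t + z) * c) (t ^ 2 * z ^ 2 * c) :=
  Polynomial.funext fun x => by
    simp only [twoRoots, eval_quintic, eval_mul, eval_pow, eval_sub, eval_add, eval_X, eval_C]
    ring

lemma eval_edge_twoRoots (t z a c w : ℝ) : (edge (twoRoots t z a c)).eval w =
    a * w ^ 2 + (3 * a + (c - 2 * (t + z) * a) / 2) * w + t ^ 2 * z ^ 2 * c / 2 := by
  rw [twoRoots_eq_quintic, edge_quintic]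
  simp

lemma balance_twoRoots (t z a c : ℝ) : balance (twoRoots t z a c) =
    (1 - t) * (1 - z) * (3 * a * (1 - t) * (1 - z) - (a + c) * (t + z + 5 * t * z - 7)) := by
  rw [twoRoots_eq_quintic, balance_quintic]
  ring

lemma balance_twoRoots_eq_zero_iff (ht1 : t ≠ 1) (hz1 : z ≠ 1) :
    balance (twoRoots t z a c) = 0 ↔
      3 * a * (1 - t) * (1 - z) = (a + c) * (t + z + 5 * t * z - 7) := by
  rw [balance_twoRoots, mul_eq_zero,
    or_iff_right (mul_ne_zero (sub_ne_zero.2 ht1.symm) (sub_ne_zero.2 hz1.symm)), sub_eq_zero]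

lemma twoRoots_mem_diagCone_of_edge (ha : 0 ≤ a) (hc : 0 ≤ c)
    (hb : balance (twoRoots t z a c) = 0) (hedge : HalfLineNonneg (edge (twoRoots t z a c))) :
    twoRoots t z a c ∈ diagCone :=
  ⟨twoRoots_eq_quintic t z a c ▸ natDegree_quintic_le .., hb,
    ((halfLineNonneg_sq _).mul (halfLineNonneg_sq _)).mul (halfLineNonneg_linear ha hc), hedge⟩

lemma one_sub_mul_one_sub_neg (ht : 0 ≤ t) (ht1 : t ≠ 1) (hz1 : z ≠ 1) (ha : 0 ≤ a) (hc : 0 ≤ c)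
    (hac : 0 < a + c) (hb : 3 * a * (1 - t) * (1 - z) = (a + c) * (t + z + 5 * t * z - 7)) :
    (1 - t) * (1 - z) < 0 := by
  rcases lt_or_gt_of_ne ht1 with htlt | htgt <;> rcases lt_or_gt_of_ne hz1 with hzlt | hzgt
  · have hneg : t + z + 5 * t * z - 7 < 0 := by nlinarith
    have hnonneg : 0 ≤ 3 * a * (1 - t) * (1 - z) :=
      mul_nonneg (mul_nonneg (by positivity) (by linarith)) (by linarith)
    nlinarith
  · exact mul_neg_of_pos_of_neg (by linarith) (by linarith)
  · exact mul_neg_of_neg_of_pos (by linarith) (by linarith)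
  · have hprod : 0 < (t - 1) * (z - 1) := mul_pos (by linarith) (by linarith)
    have : 3 * ((t - 1) * (z - 1)) < t + z + 5 * t * z - 7 := by nlinarith
    have hle : 3 * a * (1 - t) * (1 - z) ≤ 3 * (a + c) * ((t - 1) * (z - 1)) := by
      have hc_mul : 0 ≤ c * ((t - 1) * (z - 1)) := by positivity
      nlinarith
    nlinarith

lemma edge_middle_nonneg {s : ℝ} (ht : 0 ≤ t) (ht1 : t < 1) (hc : 0 ≤ c) (hs : 0 ≤ s)
    (hb : 3 * (1 - t) * (1 - z) = (1 + c) * (t + z + 5 * t * z - 7)) :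
    0 ≤ 3 + c / 2 - t - z + s * t * z := by
  have hden : 0 < 4 + 2 * t + c + 5 * t * c := by positivity
  have hid : (3 + c / 2 - t - z + s * t * z) * (4 + 2 * t + c + 5 * t * c) =
      (c - 2) ^ 2 / 2 + t * (6 + 16 * c + 5 * c ^ 2 / 2 + 10 * s + 7 * c * s
        - t * (2 + 5 * c + 4 * s + c * s)) := by
    linear_combination (1 - t * s) * hb
  have ht_mul : t * (2 + 5 * c + 4 * s + c * s) ≤ 1 * (2 + 5 * c + 4 * s + c * s) :=
    mul_le_mul_of_nonneg_right ht1.le (by positivity)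
  have hbracket : 0 ≤ 6 + 16 * c + 5 * c ^ 2 / 2 + 10 * s + 7 * c * s
      - t * (2 + 5 * c + 4 * s + c * s) := by
    have : 0 ≤ c * s := by positivity
    nlinarith
  refine nonneg_of_mul_nonneg_left ?_ hden
  rw [hid]
  positivity

lemma edge_twoRoots_nonneg (ht : 0 ≤ t) (hz : 0 ≤ z) (ht1 : t ≠ 1) (hz1 : z ≠ 1)
    (ha : 0 ≤ a) (hc : 0 ≤ c) (hac : 0 < a + c) (hb : balance (twoRoots t z a c) = 0) :
    HalfLineNonneg (edge (twoRoots t z a c)) := by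
  intro w hw
  rw [eval_edge_twoRoots]
  rw [balance_twoRoots_eq_zero_iff ht1 hz1] at hb
  rcases ha.eq_or_lt with rfl | ha
  · have : 0 ≤ c / 2 * w + t ^ 2 * z ^ 2 * c / 2 := by positivity
    linarith
  · have hsq : √(2 * (c / a)) ^ 2 = 2 * (c / a) := Real.sq_sqrt (by positivity)
    have hs0 := Real.sqrt_nonneg (2 * (c / a))
    set s := √(2 * (c / a))
    have hca : c / a = s ^ 2 / 2 := by rw [hsq]; ring
    have hb' : 3 * (1 - t) * (1 - z) = (1 + c / a) * (t + z + 5 * t * z - 7) := by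
      field_simp
      linear_combination hb
    have hmiddle : 0 ≤ 3 + c / a / 2 - t - z + s * t * z := by
      have hsign := one_sub_mul_one_sub_neg ht ht1 hz1 ha.le hc hac hb
      rcases lt_or_gt_of_ne ht1 with htlt | htgt
      · exact edge_middle_nonneg ht htlt (by positivity) hs0 hb'
      · have hzlt : z < 1 := by nlinarith
        have := edge_middle_nonneg (t := z) (z := t) (c := c / a) hz hzlt (by positivity) hs0
          (by linear_combination hb')
        linarith
    calc 0 ≤ a * ((w - s * t * z / 2) ^ 2 + (3 + c / a / 2 - t - z + s * t * z) * w) := by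
          positivity
      _ = a * w ^ 2 + (3 * a + (c - 2 * (t + z) * a) / 2) * w + t ^ 2 * z ^ 2 * c / 2 := by
          rw [hca, show c = a * (s ^ 2 / 2) by rw [hsq]; field_simp]
          ring

lemma isExtremal_twoRoots (ht : 0 ≤ t) (hz : 0 ≤ z) (ht1 : t ≠ 1) (hz1 : z ≠ 1)
    (ha : 0 ≤ a) (hc : 0 ≤ c) (hac : 0 < a + c) (hb : balance (twoRoots t z a c) = 0) :
    IsExtremal diagCone (twoRoots t z a c) :=
  isExtremal_mul_of_natDegree_le_one ((convexDivisor_sq ht).mul (convexDivisor_sq hz))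
    (by simpa using ⟨sub_ne_zero.2 ht1.symm, sub_ne_zero.2 hz1.symm⟩) (linear_ne_zero hac)
    natDegree_linear_le
    (twoRoots_mem_diagCone_of_edge ha hc hb (edge_twoRoots_nonneg ht hz ht1 hz1 ha hc hac hb))

lemma balance_twoRoots_one (t a c : ℝ) : balance (twoRoots 1 t a c) = 0 := by
  rw [balance_twoRoots, sub_self, zero_mul, zero_mul]

lemma isExtremal_twoRoots_one_X (ht : 0 ≤ t) (ht2 : t ≤ 2) :
    IsExtremal diagCone (twoRoots 1 t 1 0) := by
  refine ConvexDivisor.isExtremal ?_ (twoRoots_mem_diagCone_of_edge zero_le_one le_rfl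
    (balance_twoRoots_one ..) fun w hw => ?_)
  · rw [twoRoots, C_1, C_0, one_mul, add_zero]
    exact ((convexDivisor_sq zero_le_one).mul (convexDivisor_sq ht)).mul convexDivisor_X
  · rw [eval_edge_twoRoots]
    nlinarith [mul_nonneg hw (sub_nonneg.2 ht2), sq_nonneg w]

lemma isExtremal_twoRoots_one_C (ht : 0 ≤ t) : IsExtremal diagCone (twoRoots 1 t 0 1) := by
  refine ConvexDivisor.isExtremal ?_ (twoRoots_mem_diagCone_of_edge le_rfl zero_le_one
    (balance_twoRoots_one ..) fun w hw => ?_)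
  · rw [twoRoots, C_1, C_0, zero_mul, zero_add, mul_one]
    exact (convexDivisor_sq zero_le_one).mul (convexDivisor_sq ht)
  · rw [eval_edge_twoRoots]
    nlinarith [sq_nonneg t]

/-- The quantity that has to be nonnegative for `edgeRoot t v` to be nonnegative on the
half-line. -/
def edgeGap (t v : ℝ) : ℝ := t - 2 - v ^ 2 - 2 * t * v

/-- The quintic with a double root at `t` and leading coefficient `1` for which `edge` is the
square of `X - t v`. -/
def edgeRoot (t v : ℝ) : ℝ[X] :=
  (X - C t) ^ 2 * (C (2 * v ^ 2) * (X - C 1) ^ 2 + X * ((X - C 1) ^ 2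
    + C (2 * edgeGap t v) * (X - C 1) + C (3 * (t - 1) / (t + 2) * edgeGap t v)))

lemma sq_mul_cubic_eq_quintic (t k₃ k₂ k₁ k₀ : ℝ) :
    (X - C t) ^ 2 * (C k₃ * X ^ 3 + C k₂ * X ^ 2 + C k₁ * X + C k₀) =
      quintic k₃ (k₂ - 2 * t * k₃) (k₁ - 2 * t * k₂ + t ^ 2 * k₃) (k₀ - 2 * t * k₁ + t ^ 2 * k₂)
        (t ^ 2 * k₁ - 2 * t * k₀) (t ^ 2 * k₀) :=
  Polynomial.funext fun x => by
    simp only [eval_quintic, eval_mul, eval_pow, eval_sub, eval_add, eval_X, eval_C]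
    ring

lemma edgeRoot_eq_sq_mul_cubic (t v : ℝ) : edgeRoot t v =
    (X - C t) ^ 2 * (C 1 * X ^ 3 + C (2 * t - 6 - 4 * t * v) * X ^ 2
      + C (3 * (t - 1) / (t + 2) * edgeGap t v - 2 * t + 5 + 4 * t * v - 2 * v ^ 2) * X
      + C (2 * v ^ 2)) :=
  Polynomial.funext fun x => by
    simp only [edgeRoot, edgeGap, eval_mul, eval_pow, eval_sub, eval_add, eval_X, eval_C]
    ring

lemma natDegree_edgeRoot_le (t v : ℝ) : (edgeRoot t v).natDegree ≤ 5 := by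
  rw [edgeRoot_eq_sq_mul_cubic, sq_mul_cubic_eq_quintic]
  exact natDegree_quintic_le ..

lemma edge_edgeRoot (t v : ℝ) : edge (edgeRoot t v) = (X - C (t * v)) ^ 2 := by
  rw [edgeRoot_eq_sq_mul_cubic, sq_mul_cubic_eq_quintic, edge_quintic]
  refine Polynomial.funext fun w => ?_
  simp only [eval_add, eval_mul, eval_pow, eval_sub, eval_X, eval_C]
  ring

lemma balance_edgeRoot (ht : t + 2 ≠ 0) (v : ℝ) : balance (edgeRoot t v) = 0 := by
  rw [edgeRoot_eq_sq_mul_cubic, sq_mul_cubic_eq_quintic, balance_quintic, edgeGap]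
  field_simp
  ring

lemma edgeRoot_ne_zero (t v : ℝ) : edgeRoot t v ≠ 0 := fun h =>
  pow_ne_zero 2 (X_sub_C_ne_zero (t * v)) (by rw [← edge_edgeRoot, h, map_zero])

lemma edgeRoot_mem_diagCone {v : ℝ} (ht : 2 ≤ t) (hv : 0 ≤ v) (hn : 0 ≤ edgeGap t v) :
    edgeRoot t v ∈ diagCone := by
  refine ⟨natDegree_edgeRoot_le t v, balance_edgeRoot (by linarith) v, fun x hx => ?_,
    edge_edgeRoot t v ▸ halfLineNonneg_sq _⟩
  have hgap_le : edgeGap t v ≤ t - 2 := by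
    have : 0 ≤ t * v := by positivity
    rw [edgeGap]
    nlinarith [sq_nonneg v]
  simp only [edgeRoot, eval_mul, eval_pow, eval_sub, eval_add, eval_X, eval_C]
  set n := edgeGap t v
  set m := 3 * (t - 1) / (t + 2)
  have hm : m * (t + 2) = 3 * (t - 1) := div_mul_cancel₀ _ (by linarith)
  have hquad : 0 ≤ (x - 1) ^ 2 + 2 * n * (x - 1) + m * n := by
    rcases le_total n 1 with hn1 | hn1
    · have hnm : n ≤ m := by
        rw [le_div_iff₀ (by linarith)]
        nlinarith
      nlinarith [sq_nonneg (x - 1 + n)]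
    · have hsq : 0 ≤ 1 - 2 * n + m * n := by
        refine nonneg_of_mul_nonneg_left (b := t + 2) ?_ (by linarith)
        have : (1 - 2 * n + m * n) * (t + 2) = t + 2 - (7 - t) * n := by linear_combination n * hm
        rw [this]
        rcases le_total t 7 with _ | _ <;> nlinarith [sq_nonneg (t - 4)]
      nlinarith [mul_nonneg hx (sub_nonneg.2 hn1), sq_nonneg x]
  positivity

lemma natDegree_le_of_natDegree_sq_mul_le {K : ℝ[X]} {n : ℕ}
    (h : ((X - C t) ^ 2 * K).natDegree ≤ n + 2) : K.natDegree ≤ n := by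
  rcases eq_or_ne K 0 with rfl | hK
  · exact Nat.zero_le n
  · rw [natDegree_mul (pow_ne_zero _ (X_sub_C_ne_zero t)) hK, natDegree_pow, natDegree_X_sub_C]
      at h
    lia

lemma sq_mul_eq_zero_of_edge_eq_zero {K : ℝ[X]} (ht : 0 < t) (ht1 : t ≠ 1)
    (hK : ((X - C t) ^ 2 * K).natDegree ≤ 5) (hb : balance ((X - C t) ^ 2 * K) = 0)
    (he : edge ((X - C t) ^ 2 * K) = 0) : (X - C t) ^ 2 * K = 0 := by
  have hK3 : K.natDegree ≤ 3 := natDegree_le_of_natDegree_sq_mul_le hK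
  obtain ⟨k₃, k₂, k₁, k₀, rfl⟩ : ∃ k₃ k₂ k₁ k₀ : ℝ,
      K = C k₃ * X ^ 3 + C k₂ * X ^ 2 + C k₁ * X + C k₀ :=
    ⟨K.coeff 3, K.coeff 2, K.coeff 1, K.coeff 0, by
    conv_lhs => rw [K.as_sum_range_C_mul_X_pow' (Nat.lt_succ_of_le hK3)]
    simp only [Finset.sum_range_succ, Finset.sum_range_zero]
    ring⟩
  rw [sq_mul_cubic_eq_quintic] at hb he ⊢
  rw [edge_quintic] at he
  rw [balance_quintic] at hb
  have hcoeff := fun n => congrArg (fun F : ℝ[X] => F.coeff n) he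
  simp only [coeff_add, coeff_C_mul, coeff_X_pow, coeff_X, coeff_C, coeff_zero] at hcoeff
  have hk₃ : k₃ = 0 := by simpa using hcoeff 2
  have hk₂ : k₂ = 0 := by simpa [hk₃] using hcoeff 1
  have hk₀ : k₀ = 0 := by simpa [ht.ne'] using hcoeff 0
  have hk₁ : k₁ = 0 := by
    have : (1 - t) * (2 * t + 4) * k₁ = 0 := by
      rw [hk₃, hk₂, hk₀] at hb
      linear_combination hb
    exact (mul_eq_zero.1 this).resolve_left
      (mul_ne_zero (sub_ne_zero.2 ht1.symm) (by positivity))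
  simp [quintic, hk₃, hk₂, hk₁, hk₀]

lemma sq_mul_eq_smul_edgeRoot {v : ℝ} {K : ℝ[X]} (ht : 0 < t) (ht1 : t ≠ 1)
    (hK : ((X - C t) ^ 2 * K).natDegree ≤ 5) (hb : balance ((X - C t) ^ 2 * K) = 0)
    (he : edge ((X - C t) ^ 2 * K) = a • (X - C (t * v)) ^ 2) :
    (X - C t) ^ 2 * K = a • edgeRoot t v := by
  obtain ⟨L, hL⟩ : ∃ L, (X - C t) ^ 2 * K - a • edgeRoot t v = (X - C t) ^ 2 * L :=
    ⟨_, by rw [edgeRoot, ← mul_smul_comm, ← mul_sub]⟩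
  have hdeg : ((X - C t) ^ 2 * L).natDegree ≤ 5 := hL ▸ (natDegree_sub_le_of_le hK
    ((natDegree_smul_le _ _).trans (natDegree_edgeRoot_le t v))).trans_eq (max_self 5)
  refine sub_eq_zero.1 (hL ▸ sq_mul_eq_zero_of_edge_eq_zero ht ht1 hdeg ?_ ?_)
  · rw [← hL, map_sub, map_smul, hb, balance_edgeRoot (by positivity), smul_zero, sub_zero]
  · rw [← hL, map_sub, map_smul, he, edge_edgeRoot, sub_self]

lemma exists_edge_eq_smul_sq {F : ℝ[X]} {w : ℝ} (h : (X - C w) ^ 2 ∣ edge F) :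
    ∃ a : ℝ, edge F = a • (X - C w) ^ 2 := by
  obtain ⟨E, hE⟩ := h
  have hE0 : E.natDegree ≤ 0 := natDegree_le_of_natDegree_sq_mul_le (hE ▸ natDegree_edge_le F)
  exact ⟨E.coeff 0, by rw [hE, smul_eq_C_mul, mul_comm, ← eq_C_of_natDegree_le_zero hE0]⟩

lemma isExtremal_edgeRoot {v : ℝ} (ht : 2 ≤ t) (hv : 0 ≤ v) (hn : 0 ≤ edgeGap t v) :
    IsExtremal diagCone (edgeRoot t v) := by
  have ht0 : 0 < t := by linarith
  have hF := edgeRoot_mem_diagCone ht hv hn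
  refine isExtremal_of_forall_sub_mem hF (edgeRoot_ne_zero t v)
    (fun α => nonneg_of_smul_mem_diagCone hF (edgeRoot_ne_zero t v)) fun G hG hsub => ?_
  have hdvd : (X - C (t * v)) ^ 2 ∣ edge G := by
    refine (convexDivisor_sq (mul_nonneg ht0.le hv)).dvd (R := 1) hG.edge_nonneg ?_
    rw [mul_one, ← edge_edgeRoot, ← map_sub]
    exact hsub.edge_nonneg
  obtain ⟨a, ha⟩ := exists_edge_eq_smul_sq hdvd
  obtain ⟨K, rfl⟩ := (convexDivisor_sq ht0.le).dvd hG.nonneg hsub.nonneg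
  exact ⟨a, sq_mul_eq_smul_edgeRoot ht0 (by linarith) hG.natDegree_le hG.balance_eq_zero ha⟩

lemma exists_eq_smul_edgeRoot {v : ℝ} {G : ℝ[X]} (ht : 0 < t) (ht1 : t ≠ 1) (hv : 0 < v)
    (hG : G ∈ diagCone) (hroot : G.eval t = 0) (hedge : (edge G).eval (t * v) = 0) :
    ∃ α : ℝ, G = α • edgeRoot t v := by
  obtain ⟨a, ha⟩ := exists_edge_eq_smul_sq
    (hG.edge_nonneg.sq_dvd_of_eval_eq_zero (mul_pos ht hv) hedge)
  obtain ⟨K, rfl⟩ := hG.nonneg.sq_dvd_of_eval_eq_zero ht hroot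
  exact ⟨a, sq_mul_eq_smul_edgeRoot ht ht1 hG.natDegree_le hG.balance_eq_zero ha⟩

lemma exists_eq_sq_mul_sq_mul {F : ℝ[X]} (ht : 0 < t) (hz : 0 < z) (htz : t ≠ z)
    (hF : F ∈ diagCone) (h1 : F.eval t = 0) (h2 : F.eval z = 0) :
    ∃ L : ℝ[X], L.natDegree ≤ 1 ∧ F = (X - C t) ^ 2 * (X - C z) ^ 2 * L := by
  obtain ⟨K, rfl⟩ := hF.nonneg.sq_dvd_of_eval_eq_zero ht h1
  obtain ⟨L, rfl⟩ : (X - C z) ^ 2 ∣ K := by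
    refine ((halfLineNonneg_sq _).of_mul_left (pow_ne_zero 2 (X_sub_C_ne_zero t))
      hF.nonneg).sq_dvd_of_eval_eq_zero hz ?_
    simpa [sub_ne_zero.2 htz.symm] using h2
  exact ⟨L, natDegree_le_of_natDegree_sq_mul_le (natDegree_le_of_natDegree_sq_mul_le
    hF.natDegree_le), (mul_assoc ..).symm⟩

lemma exists_eq_smul_twoRoots {F : ℝ[X]} (ht : 0 < t) (hz : 0 < z) (ht1 : t ≠ 1) (hz1 : z ≠ 1)
    (htz : t ≠ z) (hac : 0 < a + c) (hb : balance (twoRoots t z a c) = 0) (hF : F ∈ diagCone)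
    (h1 : F.eval t = 0) (h2 : F.eval z = 0) : ∃ α : ℝ, F = α • twoRoots t z a c := by
  obtain ⟨L, hL, rfl⟩ := exists_eq_sq_mul_sq_mul ht hz htz hF h1 h2
  obtain ⟨α, rfl⟩ := exists_eq_smul_of_balance_eq_zero
    (by simpa using ⟨sub_ne_zero.2 ht1.symm, sub_ne_zero.2 hz1.symm⟩) (linear_ne_zero hac)
    natDegree_linear_le hL hb hF.balance_eq_zero
  exact ⟨α, mul_smul_comm α _ _⟩

lemma exists_eq_smul_twoRoots_one_X {F : ℝ[X]} (ht : 0 < t) (ht1 : t ≠ 1) (hF : F ∈ diagCone)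
    (h1 : F.eval 1 = 0) (h2 : F.eval t = 0) (h0 : F.eval 0 = 0) :
    ∃ α : ℝ, F = α • twoRoots 1 t 1 0 := by
  obtain ⟨L, hL, rfl⟩ := exists_eq_sq_mul_sq_mul one_pos ht ht1.symm hF h1 h2
  have hL0 : L.coeff 0 = 0 := by
    rw [coeff_zero_eq_eval_zero]
    simpa [ht.ne'] using h0
  have hLX : L = L.coeff 1 • X := by
    conv_lhs => rw [eq_X_add_C_of_natDegree_le_one hL, hL0, C_0, add_zero, ← smul_eq_C_mul]
  exact ⟨L.coeff 1, by rw [twoRoots, C_1, C_0, one_mul, add_zero, ← mul_smul_comm, ← hLX]⟩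

lemma exists_eq_smul_twoRoots_one_C {F : ℝ[X]} (ht : 0 < t) (ht1 : t ≠ 1) (hF : F ∈ diagCone)
    (h1 : F.eval 1 = 0) (h2 : F.eval t = 0) (h5 : F.coeff 5 = 0) :
    ∃ α : ℝ, F = α • twoRoots 1 t 0 1 := by
  obtain ⟨L, -, rfl⟩ := exists_eq_sq_mul_sq_mul one_pos ht ht1.symm hF h1 h2
  have hdeg := natDegree_le_pred hF.natDegree_le h5
  rw [mul_assoc] at hdeg
  have hL : L.natDegree ≤ 0 :=
    natDegree_le_of_natDegree_sq_mul_le (natDegree_le_of_natDegree_sq_mul_le hdeg)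
  refine ⟨L.coeff 0, ?_⟩
  rw [twoRoots, C_1, C_0, zero_mul, zero_add, mul_one, smul_eq_C_mul, mul_comm (C _),
    ← eq_C_of_natDegree_le_zero hL]

lemma exists_eq_smul_rootAndZero {F : ℝ[X]} (ht : 0 < t) (ht1 : t ≠ 1) (hac : 0 < a + c)
    (hb : balance (rootAndZero t a c) = 0) (hF : F ∈ diagCone)
    (h1 : F.eval t = 0) (h0 : F.eval 0 = 0) (h5 : F.coeff 5 = 0) :
    ∃ α : ℝ, F = α • rootAndZero t a c := by
  obtain ⟨K, rfl⟩ := hF.nonneg.sq_dvd_of_eval_eq_zero ht h1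
  have hK : K.natDegree ≤ 2 :=
    natDegree_le_of_natDegree_sq_mul_le (natDegree_le_pred hF.natDegree_le h5)
  obtain ⟨L, rfl⟩ : X ∣ K := by
    rw [X_dvd_iff, coeff_zero_eq_eval_zero]
    simpa [ht.ne'] using h0
  have hL : L.natDegree ≤ 1 := by
    rcases eq_or_ne L 0 with rfl | hL0
    · exact Nat.zero_le 1
    · rw [natDegree_X_mul hL0] at hK
      lia
  rw [mul_left_comm, ← mul_assoc] at hF ⊢
  obtain ⟨α, rfl⟩ := exists_eq_smul_of_balance_eq_zero (by simpa using sub_ne_zero.2 ht1.symm)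
    (linear_ne_zero hac) natDegree_linear_le hL hb hF.balance_eq_zero
  exact ⟨α, mul_smul_comm α _ _⟩

end Families

/-! ### Classification of the extremal restrictions -/

section Classification

variable {F H K R Y Z : ℝ[X]} {t z a c : ℝ}

lemma natDegree_mul_le_natDegree_mul_left (h0 : Z * R ≠ 0) (hd : K.natDegree ≤ R.natDegree) :
    (Z * K).natDegree ≤ (Z * R).natDegree := by
  rw [natDegree_mul (left_ne_zero_of_mul h0) (right_ne_zero_of_mul h0)]
  exact natDegree_mul_le.trans (Nat.add_le_add_left hd _)

lemma add_mul_mem_diagCone (hF : Z * R ∈ diagCone) (hF0 : Z * R ≠ 0) (hZ : HalfLineNonneg Z)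
    (hd : K.natDegree ≤ R.natDegree) (hb : balance (Z * K) = 0)
    (hK : ∀ x : ℝ, 0 ≤ x → |K.eval x| ≤ R.eval x)
    (hedge : ∀ w : ℝ, 0 ≤ w → |(edge (Z * K)).eval w| ≤ (edge (Z * R)).eval w) :
    Z * R + Z * K ∈ diagCone where
  natDegree_le := (natDegree_add_le_of_degree_le le_rfl
    (natDegree_mul_le_natDegree_mul_left hF0 hd)).trans hF.natDegree_le
  balance_eq_zero := by rw [map_add, hF.balance_eq_zero, hb, add_zero]
  nonneg := by
    rw [← mul_add]
    refine hZ.mul fun x hx => ?_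
    rw [eval_add]
    linarith [neg_le_of_abs_le (hK x hx)]
  edge_nonneg w hw := by
    rw [map_add, eval_add]
    linarith [neg_le_of_abs_le (hedge w hw)]

lemma exists_eq_smul_of_isExtremal_mul (hF : IsExtremal diagCone (Z * R))
    (hZ : HalfLineNonneg Z) (hR : HalfLinePos R) (hd : K.natDegree ≤ R.natDegree)
    (hb : balance (Z * K) = 0)
    (hedge : ∃ M : ℝ, 0 < M ∧ ∀ w : ℝ, 0 ≤ w →
      |(edge (Z * K)).eval w| ≤ M * (edge (Z * R)).eval w) : ∃ α : ℝ, K = α • R := by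
  obtain ⟨M, hM, hle_edge⟩ := hedge
  obtain ⟨N, hN, hle⟩ := hR.exists_abs_eval_le_mul hd
  obtain ⟨ε, hε, hεM, hεN⟩ : ∃ ε : ℝ, 0 < ε ∧ ε * M ≤ 1 ∧ ε * N ≤ 1 := by
    refine ⟨(M + N)⁻¹, by positivity, ?_, ?_⟩ <;>
      exact (inv_mul_le_iff₀ (by positivity)).2 (by linarith)
  have perturb : ∀ σ : ℝ, |σ| = ε → Z * R + Z * (σ • K) ∈ diagCone := fun σ hσ => by
    refine add_mul_mem_diagCone hF.1 hF.2.1 hZ ((natDegree_smul_le _ _).trans hd)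
      (by rw [mul_smul_comm, map_smul, hb, smul_zero]) (fun x hx => ?_) fun w hw => ?_
    · rw [eval_smul, smul_eq_mul, abs_mul, hσ]
      nlinarith [mul_le_mul_of_nonneg_left (hle x hx) hε.le,
        mul_le_mul_of_nonneg_right hεN (hR x hx).le]
    · rw [mul_smul_comm, map_smul, eval_smul, smul_eq_mul, abs_mul, hσ]
      nlinarith [mul_le_mul_of_nonneg_left (hle_edge w hw) hε.le,
        mul_le_mul_of_nonneg_right hεM (hF.1.edge_nonneg w hw)]
  obtain ⟨α, hα⟩ := IsExtremal.exists_eq_smul_of_add_sub_mem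
    (fun c hc G hG => smul_mem_diagCone hc hG) hF (perturb ε (abs_of_pos hε))
    (by simpa [sub_eq_add_neg] using perturb (-ε) (by rw [abs_neg, abs_of_pos hε]))
  rw [← mul_smul_comm] at hα
  exact ⟨ε⁻¹ * α, by
    rw [mul_smul, ← mul_left_cancel₀ (left_ne_zero_of_mul hF.2.1) hα, inv_smul_smul₀ hε.ne']⟩

/-- The quadratic polynomial `edge F` is a positive multiple of the square of a linear polynomial
with a root in `[0, ∞)`. -/
def EdgeSquare (F : ℝ[X]) : Prop :=
  ∃ a w₀ : ℝ, 0 < a ∧ 0 ≤ w₀ ∧ edge F = C a * (X - C w₀) ^ 2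

lemma natDegree_edge (hF : F.natDegree ≤ 5) : (edge F).natDegree = F.natDegree - 3 := by
  have hcoeff : ∀ n, F.natDegree = n + 1 → F.coeff (n + 1) ≠ 0 := fun n hn => by
    rw [← hn, coeff_natDegree, leadingCoeff_ne_zero]
    rintro rfl
    simp at hn
  simp only [edge, LinearMap.coe_mk, AddHom.coe_mk]
  rcases hF.eq_or_lt with h5 | hlt
  · rw [natDegree_quadratic (hcoeff 4 h5), h5]
  · rw [coeff_eq_zero_of_natDegree_lt hlt, C_0, zero_mul, zero_add, mul_zero, zero_add]
    rcases (Nat.le_of_lt_succ hlt).eq_or_lt with h4 | hlt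
    · rw [natDegree_linear (by simpa using hcoeff 3 h4), h4]
    · rw [coeff_eq_zero_of_natDegree_lt hlt, zero_div, C_0, zero_mul, zero_add, natDegree_C]
      lia

lemma exists_eq_smul_of_not_edgeSquare (hF : IsExtremal diagCone (Z * R)) (hZ : HalfLineNonneg Z)
    (hR : HalfLinePos R) (hS : ¬EdgeSquare (Z * R)) (hd : K.natDegree ≤ R.natDegree)
    (hb : balance (Z * K) = 0) : ∃ α : ℝ, K = α • R := by
  have hdeg := natDegree_mul_le_natDegree_mul_left hF.2.1 hd
  have hdegF := hF.1.natDegree_le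
  refine exists_eq_smul_of_isExtremal_mul hF hZ hR hd hb
    (exists_abs_eval_le_mul_of_natDegree_le_two hF.1.edge_nonneg (natDegree_edge_le _) hS ?_ ?_)
  · rw [natDegree_edge hdegF, natDegree_edge (hdeg.trans hdegF)]
    lia
  · simp only [eval_edge, coeff_zero_eq_eval_zero, eval_mul]
    intro h0
    have hZ0 : Z.eval 0 = 0 := by simpa [(hR 0 le_rfl).ne'] using h0
    simp [hZ0]

lemma exists_eq_C_of_not_edgeSquare (hF : IsExtremal diagCone ((X - C 1) ^ 2 * Y * R))
    (hY : HalfLineNonneg Y) (hR : HalfLinePos R) (hS : ¬EdgeSquare ((X - C 1) ^ 2 * Y * R)) :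
    ∃ c : ℝ, 0 < c ∧ R = C c := by
  obtain ⟨α, hα⟩ := exists_eq_smul_of_not_edgeSquare (K := 1) hF ((halfLineNonneg_sq _).mul hY)
    hR hS (by rw [natDegree_one]; exact Nat.zero_le _) (by rw [mul_assoc, balance_sq_mul])
  have hα0 : α ≠ 0 := by
    rintro rfl
    simp at hα
  have hR0 : R = C α⁻¹ := by
    rw [← mul_one (C α⁻¹), ← smul_eq_C_mul, hα, inv_smul_smul₀ hα0]
  exact ⟨α⁻¹, by simpa [hR0] using hR 0 le_rfl, hR0⟩

lemma natDegree_le_one_of_not_edgeSquare (hF : IsExtremal diagCone (Z * R))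
    (hZ : HalfLineNonneg Z) (hR : HalfLinePos R) (hS : ¬EdgeSquare (Z * R)) :
    R.natDegree ≤ 1 := by
  by_contra! hlt
  obtain ⟨α, hα⟩ := exists_eq_smul_of_not_edgeSquare (K := (X - C 1) ^ 2) hF hZ hR hS
    (by rwa [natDegree_pow, natDegree_X_sub_C]) (by rw [mul_comm, balance_sq_mul])
  have hα0 : α = 0 := by simpa [(hR 1 zero_le_one).ne'] using congrArg (eval 1) hα
  rw [hα0, zero_smul] at hα
  exact pow_ne_zero 2 (X_sub_C_ne_zero 1) hα

lemma HalfLineNonneg.exists_eq_linear (hF : HalfLineNonneg F) (hF0 : F ≠ 0)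
    (hd : F.natDegree ≤ 1) :
    ∃ a c : ℝ, 0 ≤ a ∧ 0 ≤ c ∧ 0 < a + c ∧ F = C a * X + C c := by
  have hFe := eq_X_add_C_of_natDegree_le_one hd
  have ha := hF.coeff_nonneg hd
  have hc : 0 ≤ F.coeff 0 := F.coeff_zero_eq_eval_zero ▸ hF 0 le_rfl
  refine ⟨_, _, ha, hc, (add_nonneg ha hc).lt_of_ne' fun h => hF0 ?_, hFe⟩
  obtain ⟨h1, h0⟩ := (add_eq_zero_iff_of_nonneg ha hc).1 h
  rw [hFe, h1, h0, C_0, zero_mul, zero_add]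

/-- Representatives of the extremal rays of `diagCone`. -/
inductive IsRayGenerator : ℝ[X] → Prop
  | sq_one : IsRayGenerator ((X - C 1) ^ 2)
  | X_mul_sq_one : IsRayGenerator (X * (X - C 1) ^ 2)
  | X_mul_linear : IsRayGenerator (X * (C 2 * X + C 1))
  | rootAndZero {t a c : ℝ} (ht : 0 ≤ t) (ht1 : t ≠ 1) (ha : 0 ≤ a) (hc : 0 ≤ c)
      (hac : 0 < a + c) (hb : balance (rootAndZero t a c) = 0) :
      IsRayGenerator (rootAndZero t a c)
  | twoRoots_one_X {t : ℝ} (ht : 0 ≤ t) (ht2 : t ≤ 2) : IsRayGenerator (twoRoots 1 t 1 0)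
  | twoRoots_one_C {t : ℝ} (ht : 0 ≤ t) : IsRayGenerator (twoRoots 1 t 0 1)
  | twoRoots {t z a c : ℝ} (ht : 0 ≤ t) (hz : 0 ≤ z) (ht1 : t ≠ 1) (hz1 : z ≠ 1) (ha : 0 ≤ a)
      (hc : 0 ≤ c) (hac : 0 < a + c) (hb : balance (twoRoots t z a c) = 0) :
      IsRayGenerator (twoRoots t z a c)
  | edgeRoot {t v : ℝ} (ht : 2 ≤ t) (hv : 0 ≤ v) (hn : 0 ≤ edgeGap t v) :
      IsRayGenerator (edgeRoot t v)

lemma IsRayGenerator.isExtremal (hF : IsRayGenerator F) : IsExtremal diagCone F := by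
  cases hF with
  | sq_one => exact isExtremal_sq_one
  | X_mul_sq_one => exact isExtremal_X_mul_sq_one
  | X_mul_linear => exact isExtremal_X_mul_linear
  | rootAndZero ht ht1 ha hc hac hb => exact isExtremal_rootAndZero ht ht1 ha hc hac hb
  | twoRoots_one_X ht ht2 => exact isExtremal_twoRoots_one_X ht ht2
  | twoRoots_one_C ht => exact isExtremal_twoRoots_one_C ht
  | twoRoots ht hz ht1 hz1 ha hc hac hb => exact isExtremal_twoRoots ht hz ht1 hz1 ha hc hac hb
  | edgeRoot ht hv hn => exact isExtremal_edgeRoot ht hv hn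

/-- The polynomial `F` spans the same ray as one of the representatives in `IsRayGenerator`. -/
def IsGenerated (F : ℝ[X]) : Prop := ∃ c : ℝ, 0 < c ∧ ∃ G, IsRayGenerator G ∧ F = c • G

lemma IsRayGenerator.isGenerated (hF : IsRayGenerator F) : IsGenerated F :=
  ⟨1, one_pos, F, hF, (one_smul ℝ F).symm⟩

lemma isGenerated_of_pos {ε : ℕ} (hε : ε ≤ 1) (hR : HalfLinePos R)
    (hF : IsExtremal diagCone (X ^ ε * R)) (hS : ¬EdgeSquare (X ^ ε * R)) :
    IsGenerated (X ^ ε * R) := by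
  obtain ⟨a, c, -, -, hac, rfl⟩ := HalfLineNonneg.exists_eq_linear (fun x hx => (hR x hx).le)
    hR.ne_zero (natDegree_le_one_of_not_edgeSquare hF (halfLineNonneg_X_pow ε) hR hS)
  have hb := hF.1.balance_eq_zero
  rw [balance_mul] at hb
  have hc0 : 0 < c := by simpa using hR 0 le_rfl
  interval_cases ε
  · simp only [pow_zero, derivative_one, eval_zero, eval_add, eval_mul, eval_C, eval_X, mul_one,
      zero_mul, eval_one, derivative_add, derivative_mul, derivative_C, derivative_X, zero_add,
      add_zero, one_mul] at hb
    linarith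
  · have ha2 : a = 2 * c := by
      simp only [pow_one, derivative_X, eval_one, eval_add, eval_mul, eval_C, eval_X, mul_one,
        one_mul, derivative_add, derivative_mul, derivative_C, zero_mul, zero_add, add_zero] at hb
      linarith
    refine ⟨c, hc0, _, .X_mul_linear, ?_⟩
    rw [ha2, smul_eq_C_mul]
    simp only [map_mul, C_1]
    ring

lemma isGenerated_sq_one {ε : ℕ} (hε : ε ≤ 1) (hR : HalfLinePos R)
    (hF : IsExtremal diagCone ((X - C 1) ^ 2 * X ^ ε * R))
    (hS : ¬EdgeSquare ((X - C 1) ^ 2 * X ^ ε * R)) :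
    IsGenerated ((X - C 1) ^ 2 * X ^ ε * R) := by
  obtain ⟨c, hc, rfl⟩ := exists_eq_C_of_not_edgeSquare hF (halfLineNonneg_X_pow ε) hR hS
  interval_cases ε
  · exact ⟨c, hc, _, .sq_one, by rw [smul_eq_C_mul]; ring⟩
  · exact ⟨c, hc, _, .X_mul_sq_one, by rw [smul_eq_C_mul]; ring⟩

lemma isGenerated_sq {ε : ℕ} (hε : ε ≤ 1) (ht : 0 ≤ t) (ht1 : t ≠ 1) (hR : HalfLinePos R)
    (hF : IsExtremal diagCone (X ^ ε * (X - C t) ^ 2 * R))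
    (hS : ¬EdgeSquare (X ^ ε * (X - C t) ^ 2 * R)) :
    IsGenerated (X ^ ε * (X - C t) ^ 2 * R) := by
  obtain ⟨a, c, ha, hc, hac, rfl⟩ := HalfLineNonneg.exists_eq_linear (fun x hx => (hR x hx).le)
    hR.ne_zero (natDegree_le_one_of_not_edgeSquare hF
      ((halfLineNonneg_X_pow ε).mul (halfLineNonneg_sq _)) hR hS)
  interval_cases ε
  · exfalso
    have hb := hF.1.balance_eq_zero
    rw [show X ^ 0 * (X - C t) ^ 2 * (C a * X + C c) = quintic 0 0 a (c - 2 * t * a)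
        (t ^ 2 * a - 2 * t * c) (t ^ 2 * c) from Polynomial.funext fun x => by
          simp [eval_quintic]; ring, balance_quintic] at hb
    have hprod : (1 - t) * (a * (4 + 2 * t) + c * (1 + 5 * t)) = 0 := by linear_combination hb
    have hzero := (mul_eq_zero.1 hprod).resolve_left (sub_ne_zero.2 ht1.symm)
    nlinarith [mul_nonneg ha ht, mul_nonneg hc ht]
  · rw [pow_one] at hF ⊢
    exact (IsRayGenerator.rootAndZero ht ht1 ha hc hac hF.1.balance_eq_zero).isGenerated

lemma isGenerated_sq_one_mul_sq {ε : ℕ} (hε : ε ≤ 1) (ht : 0 ≤ t) (hR : HalfLinePos R)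
    (hF : IsExtremal diagCone ((X - C 1) ^ 2 * (X ^ ε * (X - C t) ^ 2) * R))
    (hS : ¬EdgeSquare ((X - C 1) ^ 2 * (X ^ ε * (X - C t) ^ 2) * R)) :
    IsGenerated ((X - C 1) ^ 2 * (X ^ ε * (X - C t) ^ 2) * R) := by
  obtain ⟨c, hc, rfl⟩ := exists_eq_C_of_not_edgeSquare hF
    ((halfLineNonneg_X_pow ε).mul (halfLineNonneg_sq _)) hR hS
  interval_cases ε
  · refine ⟨c, hc, _, .twoRoots_one_C ht, ?_⟩
    simp only [twoRoots, smul_eq_C_mul, C_0, C_1]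
    ring
  · have hFe : (X - C 1) ^ 2 * (X ^ 1 * (X - C t) ^ 2) * C c = c • twoRoots 1 t 1 0 := by
      simp only [twoRoots, smul_eq_C_mul, C_0, C_1]
      ring
    rw [hFe] at hF ⊢
    refine ⟨c, hc, _, .twoRoots_one_X ht ?_, rfl⟩
    by_contra! ht2
    have hedge := hF.1.edge_nonneg ((t - 2) / 2) (by linarith)
    rw [map_smul, eval_smul, smul_eq_mul, eval_edge_twoRoots] at hedge
    nlinarith [nonneg_of_mul_nonneg_right hedge hc]

lemma isGenerated_sq_mul_sq {ε : ℕ} (ht : 0 ≤ t) (hz : 0 ≤ z) (ht1 : t ≠ 1) (hz1 : z ≠ 1)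
    (hR : HalfLinePos R) (hF : IsExtremal diagCone ((X - C t) ^ 2 * (X - C z) ^ 2 * (X ^ ε * R))) :
    IsGenerated ((X - C t) ^ 2 * (X - C z) ^ 2 * (X ^ ε * R)) := by
  have hd : (X ^ ε * R).natDegree ≤ 1 := by
    have hdeg := hF.1.natDegree_le
    rw [mul_assoc] at hdeg
    exact natDegree_le_of_natDegree_sq_mul_le (natDegree_le_of_natDegree_sq_mul_le hdeg)
  have hnonneg : HalfLineNonneg (X ^ ε * R) :=
    (halfLineNonneg_X_pow ε).mul fun x hx => (hR x hx).le
  obtain ⟨a, c, ha, hc, hac, he⟩ :=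
    hnonneg.exists_eq_linear (mul_ne_zero (pow_ne_zero _ X_ne_zero) hR.ne_zero) hd
  rw [he] at hF ⊢
  exact (IsRayGenerator.twoRoots ht hz ht1 hz1 ha hc hac hF.1.balance_eq_zero).isGenerated

lemma isGenerated_of_not_edgeSquare (hF : IsExtremal diagCone F) (hS : ¬EdgeSquare F) :
    IsGenerated F := by
  obtain ⟨ε, ts, R, hε, hts, rfl, hR⟩ := exists_eq_X_pow_mul_doubleRoots_mul hF.2.1 hF.1.nonneg
  have hdeg := hF.1.natDegree_le
  rw [natDegree_X_pow_mul_doubleRoots_mul ε ts hR.ne_zero] at hdeg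
  rcases ts with _ | ⟨t, _ | ⟨z, _ | ⟨s, ts⟩⟩⟩
  · rw [doubleRoots_nil, mul_one] at hF hS ⊢
    exact isGenerated_of_pos hε hR hF hS
  · have ht := hts t (by simp)
    rw [doubleRoots_cons, doubleRoots_nil, mul_one] at hF hS ⊢
    rcases eq_or_ne t 1 with rfl | ht1
    · rw [mul_comm (X ^ ε)] at hF hS ⊢
      exact isGenerated_sq_one hε hR hF hS
    · exact isGenerated_sq hε ht ht1 hR hF hS
  · have ht := hts t (by simp)
    have hz := hts z (by simp)
    rw [doubleRoots_cons, doubleRoots_cons, doubleRoots_nil, mul_one] at hF hS ⊢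
    rcases eq_or_ne t 1 with rfl | ht1
    · rw [mul_left_comm (X ^ ε)] at hF hS ⊢
      exact isGenerated_sq_one_mul_sq hε hz hR hF hS
    rcases eq_or_ne z 1 with rfl | hz1
    · rw [← mul_assoc, mul_comm _ ((X - C 1) ^ 2)] at hF hS ⊢
      exact isGenerated_sq_one_mul_sq hε ht hR hF hS
    · rw [mul_comm (X ^ ε), mul_assoc _ (X ^ ε)] at hF ⊢
      exact isGenerated_sq_mul_sq ht hz ht1 hz1 hR hF
  · simp only [List.length_cons] at hdeg
    lia

end Classification

section EdgeSquare

variable {F K R Z : ℝ[X]} {a t v w₀ : ℝ}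

lemma coeff_of_edge_eq (he : edge F = C a * (X - C w₀) ^ 2) :
    F.coeff 5 = a ∧ F.coeff 4 = -6 * a - 4 * w₀ * a ∧ F.coeff 0 = 2 * a * w₀ ^ 2 := by
  have h : ∀ w : ℝ, F.coeff 5 * w ^ 2 + (3 * F.coeff 5 + F.coeff 4 / 2) * w + F.coeff 0 / 2 =
      a * (w - w₀) ^ 2 := fun w => by
    rw [← eval_edge, he]
    simp
  have h0 := h 0
  have h1 := h 1
  have h2 := h (-1)
  refine ⟨?_, ?_, ?_⟩ <;> linarith

lemma EdgeSquare.edge_ne_zero (hS : EdgeSquare F) : edge F ≠ 0 := by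
  obtain ⟨a, w₀, ha, -, he⟩ := hS
  rw [he]
  exact mul_ne_zero (C_ne_zero.2 ha.ne') (pow_ne_zero 2 (X_sub_C_ne_zero w₀))

lemma EdgeSquare.natDegree_eq (hS : EdgeSquare F) (hd : F.natDegree ≤ 5) : F.natDegree = 5 := by
  obtain ⟨a, w₀, ha, -, he⟩ := hS
  exact hd.antisymm (le_natDegree_of_ne_zero (by rw [(coeff_of_edge_eq he).1]; exact ha.ne'))

lemma edge_mul_ne_zero (hF : IsExtremal diagCone (Z * R)) (hS : EdgeSquare (Z * R))
    (hZ : HalfLineNonneg Z) (hR : HalfLinePos R) (hK : K ≠ 0) (hd : K.natDegree ≤ R.natDegree)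
    (hb : balance (Z * K) = 0) : edge (Z * K) ≠ 0 := by
  intro he
  obtain ⟨α, rfl⟩ := exists_eq_smul_of_isExtremal_mul hF hZ hR hd hb ⟨1, one_pos, fun w hw => by
    simpa [he] using hF.1.edge_nonneg w hw⟩
  rw [mul_smul_comm, map_smul] at he
  exact hS.edge_ne_zero ((smul_eq_zero.1 he).resolve_left (left_ne_zero_of_smul hK))

lemma eval_four_eq_zero_of_X_sq_dvd (hF : F ∈ diagCone) (hS : EdgeSquare F) (h : X ^ 2 ∣ F) :
    F.eval 4 = 0 := by
  obtain ⟨a, w₀, ha, -, he⟩ := hS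
  obtain ⟨h5, h4, h0⟩ := coeff_of_edge_eq he
  have hb := hF.balance_eq_zero
  have hc0 := X_pow_dvd_iff.1 h 0 (by norm_num)
  have hc1 := X_pow_dvd_iff.1 h 1 (by norm_num)
  have hw₀ : w₀ = 0 := by simpa [hc0, ha.ne'] using h0
  rw [eq_quintic hF.natDegree_le] at hb ⊢
  rw [balance_quintic, hc0, hc1, h4, h5, hw₀] at hb
  rw [eval_quintic, hc0, hc1, h4, h5, hw₀]
  linear_combination 16 * hb

lemma sq_dvd_doubleRoots {ts : List ℝ} (ht : t ∈ ts) : (X - C t) ^ 2 ∣ doubleRoots ts :=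
  List.dvd_prod (List.mem_map_of_mem ht)

lemma eq_one_of_sq_dvd (hF : F ∈ diagCone) (hS : EdgeSquare F)
    (hroot : ∀ t, 0 < t → t ≠ 1 → F.eval t ≠ 0) (ht : 0 ≤ t) (hdvd : (X - C t) ^ 2 ∣ F) :
    t = 1 := by
  by_contra ht1
  rcases ht.eq_or_lt with rfl | ht
  · rw [C_0, sub_zero] at hdvd
    exact hroot 4 (by norm_num) (by norm_num) (eval_four_eq_zero_of_X_sq_dvd hF hS hdvd)
  · exact hroot t ht ht1 (dvd_iff_isRoot.1 ((dvd_pow_self _ two_ne_zero).trans hdvd))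

lemma not_edgeSquare_sq_one_mul_sq_one_mul (hR : R.natDegree ≤ 1) (hR0 : 0 ≤ R.coeff 0) :
    ¬EdgeSquare ((X - C 1) ^ 2 * ((X - C 1) ^ 2 * R)) := by
  rintro ⟨a, w₀, ha, hw₀, he⟩
  have hFe : (X - C 1) ^ 2 * ((X - C 1) ^ 2 * R) =
      quintic (R.coeff 1) (R.coeff 0 - 4 * R.coeff 1) (6 * R.coeff 1 - 4 * R.coeff 0)
        (6 * R.coeff 0 - 4 * R.coeff 1) (R.coeff 1 - 4 * R.coeff 0) (R.coeff 0) := by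
    conv_lhs => rw [eq_X_add_C_of_natDegree_le_one hR]
    exact Polynomial.funext fun x => by simp [eval_quintic]; ring
  have heval := fun w => congrArg (eval w) he
  simp only [hFe, edge_quintic, eval_add, eval_mul, eval_pow, eval_sub, eval_C,
    eval_X] at heval
  have : 0 ≤ a * w₀ := by positivity
  linarith [heval 0, heval 1, heval (-1)]

lemma X_pow_mul_X_pow_one_sub {ε : ℕ} (hε : ε ≤ 1) : (X : ℝ[X]) ^ ε * X ^ (1 - ε) = X := by
  rw [← pow_add, Nat.add_sub_cancel' hε, pow_one]

lemma not_edgeSquare_X_pow_mul {ε : ℕ} (hε : ε ≤ 1) (hR : HalfLinePos R)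
    (hF : IsExtremal diagCone (X ^ ε * R)) : ¬EdgeSquare (X ^ ε * R) := fun hS => by
  have hZK : X ^ ε * (X ^ (1 - ε) * (C 2 * X + C 1)) = quintic 0 0 0 2 1 0 := by
    rw [← mul_assoc, X_pow_mul_X_pow_one_sub hε]
    exact Polynomial.funext fun x => by simp [eval_quintic]; ring
  have hdeg := hS.natDegree_eq hF.1.natDegree_le
  rw [(monic_X_pow ε).natDegree_mul' hR.ne_zero, natDegree_X_pow] at hdeg
  have hd : (X ^ (1 - ε) * (C 2 * X + C 1) : ℝ[X]).natDegree ≤ R.natDegree := by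
    rw [(monic_X_pow _).natDegree_mul' (linear_ne_zero (by norm_num)), natDegree_linear two_ne_zero,
      natDegree_X_pow]
    lia
  exact edge_mul_ne_zero hF hS (halfLineNonneg_X_pow ε) hR
    (mul_ne_zero (pow_ne_zero _ X_ne_zero) (linear_ne_zero (by norm_num))) hd
    (by rw [hZK, balance_quintic]; norm_num) (by rw [hZK, edge_quintic]; simp)

lemma not_edgeSquare_sq_one_mul {ε : ℕ} (hε : ε ≤ 1) (hR : HalfLinePos R)
    (hF : IsExtremal diagCone ((X - C 1) ^ 2 * X ^ ε * R)) :
    ¬EdgeSquare ((X - C 1) ^ 2 * X ^ ε * R) := fun hS => by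
  have hZK : (X - C 1) ^ 2 * X ^ ε * X ^ (1 - ε) = quintic 0 0 1 (-2) 1 0 := by
    rw [mul_assoc, X_pow_mul_X_pow_one_sub hε]
    exact Polynomial.funext fun x => by simp [eval_quintic]; ring
  have hdeg := hS.natDegree_eq hF.1.natDegree_le
  rw [(((monic_X_sub_C 1).pow 2).mul (monic_X_pow ε)).natDegree_mul' hR.ne_zero,
    ((monic_X_sub_C 1).pow 2).natDegree_mul (monic_X_pow ε), natDegree_pow, natDegree_X_sub_C,
    natDegree_X_pow] at hdeg
  have hd : (X ^ (1 - ε) : ℝ[X]).natDegree ≤ R.natDegree := by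
    rw [natDegree_X_pow]
    lia
  exact edge_mul_ne_zero hF hS ((halfLineNonneg_sq _).mul (halfLineNonneg_X_pow ε)) hR
    (pow_ne_zero _ X_ne_zero) hd
    (by rw [hZK, balance_quintic]; norm_num) (by rw [hZK, edge_quintic]; simp)

lemma exists_root_of_edgeSquare (hF : IsExtremal diagCone F) (hS : EdgeSquare F) :
    ∃ t : ℝ, 0 < t ∧ t ≠ 1 ∧ F.eval t = 0 := by
  by_contra! hroot
  obtain ⟨ε, ts, R, hε, hts, rfl, hR⟩ := exists_eq_X_pow_mul_doubleRoots_mul hF.2.1 hF.1.nonneg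
  have hts1 : ∀ t ∈ ts, t = 1 := fun t ht => eq_one_of_sq_dvd hF.1 hS hroot (hts t ht)
    (((sq_dvd_doubleRoots ht).mul_left _).mul_right _)
  have hdeg := hS.natDegree_eq hF.1.natDegree_le
  rw [natDegree_X_pow_mul_doubleRoots_mul ε ts hR.ne_zero] at hdeg
  rcases ts with _ | ⟨t, _ | ⟨z, _ | ⟨s, ts⟩⟩⟩
  · rw [doubleRoots_nil, mul_one] at hF hS
    exact not_edgeSquare_X_pow_mul hε hR hF hS
  · obtain rfl := hts1 t (by simp)
    rw [doubleRoots_cons, doubleRoots_nil, mul_one, mul_comm (X ^ ε)] at hF hS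
    exact not_edgeSquare_sq_one_mul hε hR hF hS
  · obtain rfl := hts1 t (by simp)
    obtain rfl := hts1 z (by simp)
    rw [doubleRoots_cons, doubleRoots_cons, doubleRoots_nil, mul_one, mul_comm (X ^ ε), mul_assoc,
      mul_assoc] at hS
    refine not_edgeSquare_sq_one_mul_sq_one_mul ?_ ?_ hS
    · rw [(monic_X_pow ε).natDegree_mul' hR.ne_zero, natDegree_X_pow]
      simp only [List.length_cons] at hdeg
      lia
    · rw [coeff_zero_eq_eval_zero, eval_mul, eval_pow, eval_X]
      exact mul_nonneg (pow_nonneg le_rfl ε) (hR 0 le_rfl).le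
  · simp only [List.length_cons] at hdeg
    lia

lemma two_le_of_edgeRoot_nonneg (ht : 0 < t) (ht1 : t ≠ 1) (hv : 0 ≤ v)
    (hF : HalfLineNonneg (edgeRoot t v)) : 2 ≤ t ∧ 0 ≤ edgeGap t v := by
  rw [edgeRoot] at hF
  have hcofactor : ∀ x : ℝ, 0 ≤ x → 0 ≤ (t + 2) * (2 * v ^ 2 * (x - 1) ^ 2 + x * (x - 1) ^ 2
      + 2 * x * edgeGap t v * (x - 1)) + 3 * (t - 1) * x * edgeGap t v := fun x hx => by
    have hQ := (halfLineNonneg_sq _).of_mul_left (pow_ne_zero 2 (X_sub_C_ne_zero t)) hF x hx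
    simp only [eval_mul, eval_add, eval_sub, eval_pow, eval_X, eval_C] at hQ
    refine (mul_nonneg (by positivity : (0 : ℝ) ≤ t + 2) hQ).trans_eq ?_
    field_simp
    ring
  have hgap : 0 ≤ (t - 1) * edgeGap t v := by linarith [hcofactor 1 zero_le_one]
  have ht1 : 1 < t := by
    refine ht1.lt_or_gt.resolve_left fun hlt => ?_
    have h4 := hcofactor 4 (by norm_num)
    have h3 := hcofactor 3 (by norm_num)
    rw [edgeGap] at h3 h4
    have hv2 : v ^ 2 ≤ 2 * t := by nlinarith [mul_nonneg hv ht.le]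
    have : 0 ≤ v * (42 * t ^ 2 + 30 * t) := by positivity
    have : (21 * t + 6) * (t - 1) < 0 := mul_neg_of_pos_of_neg (by positivity) (by linarith)
    rcases le_total (1 - 13 * t) 0 with h9 | h9
    · nlinarith [mul_nonneg (sq_nonneg v) (neg_nonneg.2 h9)]
    · nlinarith [mul_le_mul_of_nonneg_right hv2 h9]
  have hgap := nonneg_of_mul_nonneg_right hgap (sub_pos.2 ht1)
  have : 0 ≤ t * v := by positivity
  exact ⟨by rw [edgeGap] at hgap; nlinarith [sq_nonneg v], hgap⟩

lemma isGenerated_of_edgeSquare (hF : IsExtremal diagCone F) (hS : EdgeSquare F) :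
    IsGenerated F := by
  obtain ⟨t, ht, ht1, hroot⟩ := exists_root_of_edgeSquare hF hS
  obtain ⟨a, w₀, ha, hw₀, he⟩ := hS
  obtain ⟨v, hv, rfl⟩ : ∃ v, 0 ≤ v ∧ w₀ = t * v :=
    ⟨w₀ / t, by positivity, (mul_div_cancel₀ w₀ ht.ne').symm⟩
  obtain ⟨K, rfl⟩ := hF.1.nonneg.sq_dvd_of_eval_eq_zero ht hroot
  have hFe := sq_mul_eq_smul_edgeRoot ht ht1 hF.1.natDegree_le hF.1.balance_eq_zero
    (he.trans (smul_eq_C_mul a).symm)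
  rw [hFe] at hF ⊢
  have hnonneg : HalfLineNonneg (edgeRoot t v) := fun x hx => by
    have := hF.1.nonneg x hx
    rw [eval_smul, smul_eq_mul] at this
    exact nonneg_of_mul_nonneg_right this ha
  obtain ⟨ht2, hn⟩ := two_le_of_edgeRoot_nonneg ht ht1 hv hnonneg
  exact ⟨a, ha, _, .edgeRoot ht2 hv hn, rfl⟩

theorem isExtremal_diagCone_iff : IsExtremal diagCone F ↔ IsGenerated F := by
  refine ⟨fun hF => ?_, ?_⟩
  · by_cases hS : EdgeSquare F
    · exact isGenerated_of_edgeSquare hF hS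
    · exact isGenerated_of_not_edgeSquare hF hS
  · rintro ⟨c, hc, G, hG, rfl⟩
    exact hG.isExtremal.smul (fun c hc G hG => smul_mem_diagCone hc hG) hc

end EdgeSquare

end SymQuintic

namespace SymQuintic

open MvPolynomial

/-! ### Symmetric quintic forms in three variables -/

/-- The symmetric quintic form with coordinates `p₀, …, p₄` in the basis `s₀, …, s₄`. -/
def symQuintic (p₀ p₁ p₂ p₃ p₄ : ℝ) : Poly3 :=
  p₀ • s0 + p₁ • s1 + p₂ • s2 + p₃ • s3 + p₄ • s4

lemma eval_symQuintic (p₀ p₁ p₂ p₃ p₄ : ℝ) (a : Fin 3 → ℝ) :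
    eval a (symQuintic p₀ p₁ p₂ p₃ p₄) =
      p₀ * (a 0 ^ 5 + a 1 ^ 5 + a 2 ^ 5)
      + p₁ * (a 0 ^ 4 * (a 1 + a 2) + a 1 ^ 4 * (a 2 + a 0) + a 2 ^ 4 * (a 0 + a 1))
      + p₂ * (a 0 ^ 3 * (a 1 ^ 2 + a 2 ^ 2) + a 1 ^ 3 * (a 2 ^ 2 + a 0 ^ 2)
        + a 2 ^ 3 * (a 0 ^ 2 + a 1 ^ 2))
      + p₃ * (a 0 * a 1 * a 2 * (a 0 ^ 2 + a 1 ^ 2 + a 2 ^ 2))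
      + (p₄ - p₀ - 2 * p₁ - 2 * p₂ - p₃)
        * (a 0 * a 1 * a 2 * (a 0 * a 1 + a 1 * a 2 + a 2 * a 0)) := by
  simp only [symQuintic, s0, s1, s2, s3, s4, S1, S2, T2, U, map_add, map_sub, map_mul, smul_eval,
    map_pow, eval_X, map_ofNat]
  ring

section Membership

lemma mul_mem_symForms {k m n : ℕ} {f g : MvPolynomial (Fin k) ℝ} (hf : f ∈ symForms k m)
    (hg : g ∈ symForms k n) : f * g ∈ symForms k (m + n) :=
  ⟨IsHomogeneous.mul hf.1 hg.1, Subalgebra.mul_mem _ hf.2 hg.2⟩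

lemma psum_mem_symForms (k n : ℕ) : psum (Fin k) ℝ n ∈ symForms k n :=
  ⟨IsHomogeneous.sum _ _ _ fun i _ => isHomogeneous_X_pow i n, psum_isSymmetric _ _ n⟩

lemma S1_mem (n : ℕ) : S1 n ∈ symForms 3 n := by
  rw [show S1 n = psum (Fin 3) ℝ n by rw [S1, psum, Fin.sum_univ_three]]
  exact psum_mem_symForms 3 n

lemma T2_mem (m n : ℕ) : T2 m n ∈ symForms 3 (m + n) := by
  have : T2 m n = S1 m * S1 n - S1 (m + n) := by
    simp only [T2, S2, S1]
    ring
  rw [this]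
  exact sub_mem (mul_mem_symForms (S1_mem m) (S1_mem n)) (S1_mem _)

lemma S2_one_one_mem : S2 1 1 ∈ symForms 3 2 := by
  have : (2 : ℝ) • S2 1 1 = S1 1 * S1 1 - S1 2 := by
    rw [two_smul, S2, S1, S1]
    ring
  rw [← inv_smul_smul₀ (two_ne_zero' ℝ) (S2 1 1), this]
  exact Submodule.smul_mem _ _ (sub_mem (mul_mem_symForms (S1_mem 1) (S1_mem 1)) (S1_mem 2))

lemma U_mem : U ∈ symForms 3 3 := by
  have : U = ∏ i, X i := by rw [U, Fin.prod_univ_three]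
  refine ⟨?_, fun σ => ?_⟩
  · exact ((isHomogeneous_X ℝ _).mul (isHomogeneous_X ℝ _)).mul (isHomogeneous_X ℝ _)
  · simp only [this, map_prod, rename_X]
    exact Equiv.prod_comp σ X

lemma s4_mem : s4 ∈ symForms 3 5 := mul_mem_symForms U_mem S2_one_one_mem

lemma s3_mem : s3 ∈ symForms 3 5 := sub_mem (mul_mem_symForms U_mem (S1_mem 2)) s4_mem

lemma two_mul_s4_mem : 2 * U * S2 1 1 ∈ symForms 3 5 := by
  rw [show 2 * U * S2 1 1 = s4 + s4 by rw [s4]; ring]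
  exact add_mem s4_mem s4_mem

lemma s2_mem : s2 ∈ symForms 3 5 := sub_mem (T2_mem 3 2) two_mul_s4_mem

lemma s1_mem : s1 ∈ symForms 3 5 := sub_mem (T2_mem 4 1) two_mul_s4_mem

lemma s0_mem : s0 ∈ symForms 3 5 := sub_mem (S1_mem 5) s4_mem

lemma symQuintic_mem (p₀ p₁ p₂ p₃ p₄ : ℝ) : symQuintic p₀ p₁ p₂ p₃ p₄ ∈ symForms 3 5 :=
  have mem (c : ℝ) {f : Poly3} (hf : f ∈ symForms 3 5) := Submodule.smul_mem _ c hf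
  add_mem (add_mem (add_mem (add_mem (mem p₀ s0_mem) (mem p₁ s1_mem)) (mem p₂ s2_mem))
    (mem p₃ s3_mem)) (mem p₄ s4_mem)

end Membership

section Coefficients

variable {R ι : Type*} [CommSemiring R] {f : MvPolynomial ι R}

lemma eval_eq_sum_antidiagonalTuple {k n : ℕ} {f : MvPolynomial (Fin k) R}
    (hf : f.IsHomogeneous n) (x : Fin k → R) :
    eval x f = ∑ a ∈ Finset.Nat.antidiagonalTuple k n,
      coeff (Finsupp.equivFunOnFinite.symm a) f * ∏ i, x i ^ a i := by
  have hsupp : f.support.map Finsupp.equivFunOnFinite.toEmbedding ⊆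
      Finset.Nat.antidiagonalTuple k n := fun a ha => by
    obtain ⟨d, hd, rfl⟩ := Finset.mem_map.1 ha
    rw [Finset.Nat.mem_antidiagonalTuple]
    exact (Finsupp.degree_eq_sum d).symm.trans
      (by_contra fun h => mem_support_iff.1 hd (hf.coeff_eq_zero h))
  rw [eval_eq', ← Finset.sum_subset hsupp, Finset.sum_map]
  · refine Finset.sum_congr rfl fun d _ => ?_
    rw [Equiv.coe_toEmbedding, Equiv.symm_apply_apply]
    rfl
  · intro a _ ha
    have : coeff (Finsupp.equivFunOnFinite.symm a) f = 0 := by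
      by_contra h
      exact ha (Finset.mem_map.2 ⟨_, mem_support_iff.2 h, Equiv.apply_symm_apply _ a⟩)
    rw [this, zero_mul]

lemma coeff_comp_perm [Finite ι] (hf : f.IsSymmetric) (a : ι → ℕ) (σ : Equiv.Perm ι) :
    coeff (Finsupp.equivFunOnFinite.symm (a ∘ σ)) f =
      coeff (Finsupp.equivFunOnFinite.symm a) f := by
  have h := coeff_rename_mapDomain σ σ.injective f (Finsupp.equivFunOnFinite.symm (a ∘ σ))
  rw [hf] at h
  rw [← h]
  congr 1
  ext i
  simp [← Finsupp.equivMapDomain_eq_mapDomain]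

lemma coeff_swap_first {f : MvPolynomial (Fin 3) R} (hf : f.IsSymmetric) (a b c : ℕ) :
    coeff (Finsupp.equivFunOnFinite.symm ![b, a, c]) f =
      coeff (Finsupp.equivFunOnFinite.symm ![a, b, c]) f := by
  rw [← coeff_comp_perm hf ![a, b, c] (Equiv.swap 0 1)]
  congr 2
  ext i
  fin_cases i <;> rfl

lemma coeff_swap_last {f : MvPolynomial (Fin 3) R} (hf : f.IsSymmetric) (a b c : ℕ) :
    coeff (Finsupp.equivFunOnFinite.symm ![a, c, b]) f =
      coeff (Finsupp.equivFunOnFinite.symm ![a, b, c]) f := by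
  rw [← coeff_comp_perm hf ![a, b, c] (Equiv.swap 1 2)]
  congr 2
  ext i
  fin_cases i <;> rfl

end Coefficients

lemma antidiagonalTuple_three_five : Finset.Nat.antidiagonalTuple 3 5 =
    {![0, 0, 5], ![0, 5, 0], ![5, 0, 0],
      ![0, 1, 4], ![0, 4, 1], ![1, 0, 4], ![1, 4, 0], ![4, 0, 1], ![4, 1, 0],
      ![0, 2, 3], ![0, 3, 2], ![2, 0, 3], ![2, 3, 0], ![3, 0, 2], ![3, 2, 0],
      ![1, 1, 3], ![1, 3, 1], ![3, 1, 1], ![1, 2, 2], ![2, 1, 2], ![2, 2, 1]} := by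
  decide

lemma exists_eq_symQuintic {f : Poly3} (hf : f ∈ symForms 3 5) :
    ∃ p₀ p₁ p₂ p₃ p₄ : ℝ, f = symQuintic p₀ p₁ p₂ p₃ p₄ := by
  set c : ℕ → ℕ → ℕ → ℝ := fun i j k => coeff (Finsupp.equivFunOnFinite.symm ![i, j, k]) f with hc
  have hswap : ∀ i j k, j < i → c i j k = c j i k := fun i j k _ => coeff_swap_first hf.2 j i k
  have hswap' : ∀ i j k, k < j → c i j k = c i k j := fun i j k _ => coeff_swap_last hf.2 i k j
  refine ⟨c 0 0 5, c 0 1 4, c 0 2 3, c 1 1 3,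
    c 1 2 2 + c 0 0 5 + 2 * c 0 1 4 + 2 * c 0 2 3 + c 1 1 3, MvPolynomial.funext fun x => ?_⟩
  have hx : eval x f = ∑ a ∈ Finset.Nat.antidiagonalTuple 3 5,
      c (a 0) (a 1) (a 2) * ∏ i, x i ^ a i := by
    have heta : ∀ a : Fin 3 → ℕ, ![a 0, a 1, a 2] = a := FinVec.etaExpand_eq
    simp only [eval_eq_sum_antidiagonalTuple hf.1, hc, heta]
  rw [antidiagonalTuple_three_five] at hx
  repeat rw [Finset.sum_insert (by decide)] at hx
  simp (disch := norm_num) only [Finset.sum_singleton, hswap, hswap', Fin.prod_univ_three,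
    Matrix.cons_val] at hx
  rw [hx, eval_symQuintic]
  ring

section Restriction

/-- The restriction `f(x, 1, 1)` of a ternary form `f`. -/
def diag : Poly3 →ₐ[ℝ] Polynomial ℝ := aeval ![Polynomial.X, 1, 1]

lemma eval_diag (x : ℝ) (f : Poly3) : (diag f).eval x = eval ![x, 1, 1] f := by
  have : (Polynomial.evalRingHom x).comp (diag : Poly3 →+* Polynomial ℝ) =
      (eval ![x, 1, 1] : Poly3 →+* ℝ) := by
    ext i
    · simp [diag]
    · fin_cases i <;> simp [diag]
  exact congrArg (fun φ : Poly3 →+* ℝ => φ f) this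

lemma diag_symQuintic (p₀ p₁ p₂ p₃ p₄ : ℝ) : diag (symQuintic p₀ p₁ p₂ p₃ p₄) =
    quintic p₀ (2 * p₁) (2 * p₂ + p₃) (2 * p₄ - 2 * p₀ - 4 * p₁ - 2 * p₂ - 2 * p₃)
      (p₄ - p₀ - 2 * p₂ + p₃) (2 * p₀ + 2 * p₁ + 2 * p₂) := by
  refine Polynomial.funext fun x => ?_
  rw [eval_diag, eval_symQuintic, eval_quintic]
  simp only [Matrix.cons_val]
  ring

lemma natDegree_diag_le {f : Poly3} (hf : f ∈ symForms 3 5) : (diag f).natDegree ≤ 5 := by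
  obtain ⟨p₀, p₁, p₂, p₃, p₄, rfl⟩ := exists_eq_symQuintic hf
  rw [diag_symQuintic]
  exact natDegree_quintic_le _ _ _ _ _ _

lemma balance_diag {f : Poly3} (hf : f ∈ symForms 3 5) : balance (diag f) = 0 := by
  obtain ⟨p₀, p₁, p₂, p₃, p₄, rfl⟩ := exists_eq_symQuintic hf
  rw [diag_symQuintic, balance_quintic]
  ring

lemma injOn_diag : Set.InjOn diag (symForms 3 5 : Set Poly3) := fun f hf g hg h => by
  obtain ⟨p₀, p₁, p₂, p₃, p₄, rfl⟩ := exists_eq_symQuintic hf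
  obtain ⟨r₀, r₁, r₂, r₃, r₄, rfl⟩ := exists_eq_symQuintic hg
  rw [diag_symQuintic, diag_symQuintic, quintic_inj] at h
  congr 1 <;> linarith

lemma exists_diag_eq {F : Polynomial ℝ} (hd : F.natDegree ≤ 5) (hb : balance F = 0) :
    ∃ f ∈ symForms 3 5, diag f = F := by
  refine ⟨symQuintic (F.coeff 5) (F.coeff 4 / 2) (F.coeff 0 / 2 - F.coeff 5 - F.coeff 4 / 2)
    (F.coeff 3 - F.coeff 0 + 2 * F.coeff 5 + F.coeff 4)
    ((F.coeff 5 + F.coeff 4 + F.coeff 3 + F.coeff 2 + F.coeff 1 + F.coeff 0) / 3),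
    symQuintic_mem _ _ _ _ _, ?_⟩
  rw [eq_quintic hd, balance_quintic] at hb
  rw [diag_symQuintic]
  conv_rhs => rw [eq_quintic hd]
  congr 1 <;> linarith

end Restriction

section Boundary

lemma exists_eval_eq_add_mul {f : Poly3} (hf : f ∈ symForms 3 5) :
    ∃ A B : ℝ → ℝ → ℝ, ∀ x y z : ℝ, eval ![x, y, z] f =
      A (x + y + z) (x * y + y * z + z * x) +
        B (x + y + z) (x * y + y * z + z * x) * (x * y * z) := by
  obtain ⟨p₀, p₁, p₂, p₃, p₄, rfl⟩ := exists_eq_symQuintic hf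
  refine ⟨fun s q => p₀ * (s ^ 5 - 5 * s ^ 3 * q + 5 * s * q ^ 2)
      + p₁ * (s ^ 3 * q - 3 * s * q ^ 2) + p₂ * (s * q ^ 2),
    fun s q => p₀ * (5 * s ^ 2 - 5 * q) + p₁ * (-s ^ 2 + 5 * q) + p₂ * (-2 * s ^ 2 - q)
      + p₃ * (s ^ 2 - 2 * q) + (p₄ - p₀ - 2 * p₁ - 2 * p₂ - p₃) * q, fun x y z => ?_⟩
  rw [eval_symQuintic]
  simp only [Matrix.cons_val]
  ring

variable {x y z : ℝ}

/-- The double roots of the monic cubics with the elementary symmetric functions `s = x + y + z`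
and `q = xy + yz + zx` are `(s ± δ) / 3`, where `δ = √(s² - 3q)`; the second inequality is the
nonnegativity of the discriminant. -/
lemma exists_abs_sub_le (hx : 0 ≤ x) (hy : 0 ≤ y) (hz : 0 ≤ z) :
    ∃ δ : ℝ, 0 ≤ δ ∧ δ ≤ x + y + z ∧
      δ ^ 2 = (x + y + z) ^ 2 - 3 * (x * y + y * z + z * x) ∧
      |27 * (x * y * z) - ((x + y + z) ^ 3 - 3 * (x + y + z) * δ ^ 2)| ≤ 2 * δ ^ 3 := by
  have hq : 0 ≤ x * y + y * z + z * x := by positivity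
  have hδ : √((x + y + z) ^ 2 - 3 * (x * y + y * z + z * x)) ^ 2 =
      (x + y + z) ^ 2 - 3 * (x * y + y * z + z * x) :=
    Real.sq_sqrt (by linarith [sq_nonneg (x - y), sq_nonneg (y - z), sq_nonneg (z - x)])
  have hδ0 := Real.sqrt_nonneg ((x + y + z) ^ 2 - 3 * (x * y + y * z + z * x))
  set δ := √((x + y + z) ^ 2 - 3 * (x * y + y * z + z * x))
  have hδs : δ ≤ x + y + z := le_of_sq_le_sq (by linarith) (by positivity)
  have hdisc : (2 * δ ^ 3) ^ 2 -
      (27 * (x * y * z) - ((x + y + z) ^ 3 - 3 * (x + y + z) * δ ^ 2)) ^ 2 =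
        27 * ((x - y) * (y - z) * (z - x)) ^ 2 := by
    rw [show (2 * δ ^ 3) ^ 2 = 4 * (δ ^ 2) ^ 3 by ring, hδ]
    ring
  refine ⟨δ, hδ0, hδs, hδ, abs_le_of_sq_le_sq (sub_nonneg.1 ?_) (by positivity)⟩
  rw [hdisc]
  positivity

lemma exists_prod_le_mul_sq (hx : 0 ≤ x) (hy : 0 ≤ y) (hz : 0 ≤ z) :
    ∃ a b : ℝ, 0 ≤ a ∧ 0 ≤ b ∧ b + a + a = x + y + z ∧
      b * a + a * a + a * b = x * y + y * z + z * x ∧ x * y * z ≤ b * a * a := by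
  obtain ⟨δ, hδ0, hδs, hδ, hV⟩ := exists_abs_sub_le hx hy hz
  refine ⟨(x + y + z - δ) / 3, (x + y + z + 2 * δ) / 3, by linarith, by linarith, by ring,
    by linear_combination -hδ / 3, ?_⟩
  linear_combination (abs_le.1 hV).2 / 27

lemma exists_mul_sq_le_prod_or (hx : 0 ≤ x) (hy : 0 ≤ y) (hz : 0 ≤ z) :
    (∃ a b : ℝ, 0 ≤ a ∧ 0 ≤ b ∧ b + a + a = x + y + z ∧
      b * a + a * a + a * b = x * y + y * z + z * x ∧ b * a * a ≤ x * y * z) ∨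
    ∃ u v : ℝ, 0 ≤ u ∧ 0 ≤ v ∧ 0 + u + v = x + y + z ∧
      0 * u + u * v + v * 0 = x * y + y * z + z * x := by
  obtain ⟨δ, hδ0, hδs, hδ, hV⟩ := exists_abs_sub_le hx hy hz
  rcases le_or_gt (2 * δ) (x + y + z) with h2δ | h2δ
  · refine .inl ⟨(x + y + z + δ) / 3, (x + y + z - 2 * δ) / 3, by linarith, by linarith, by ring,
      by linear_combination -hδ / 3, ?_⟩
    linear_combination (abs_le.1 hV).1 / 27
  · have hq : 0 ≤ x * y + y * z + z * x := by positivity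
    have h4q : 0 ≤ (x + y + z) ^ 2 - 4 * (x * y + y * z + z * x) := by nlinarith
    have hr := Real.sq_sqrt h4q
    have hr0 := Real.sqrt_nonneg ((x + y + z) ^ 2 - 4 * (x * y + y * z + z * x))
    set r := √((x + y + z) ^ 2 - 4 * (x * y + y * z + z * x))
    have hrs : r ≤ x + y + z := le_of_sq_le_sq (by linarith) (by positivity)
    exact .inr ⟨(x + y + z + r) / 2, (x + y + z - r) / 2, by linarith, by linarith, by ring,
      by linear_combination -hr / 4⟩

lemma eval_nonneg_of_boundary {f : Poly3} (hf : f ∈ symForms 3 5)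
    (hpair : ∀ a b : ℝ, 0 ≤ a → 0 ≤ b → 0 ≤ eval ![b, a, a] f)
    (hface : ∀ u v : ℝ, 0 ≤ u → 0 ≤ v → 0 ≤ eval ![0, u, v] f)
    (hx : 0 ≤ x) (hy : 0 ≤ y) (hz : 0 ≤ z) : 0 ≤ eval ![x, y, z] f := by
  obtain ⟨A, B, hAB⟩ := exists_eval_eq_add_mul hf
  rw [hAB]
  rcases le_total (B (x + y + z) (x * y + y * z + z * x)) 0 with hB | hB
  · obtain ⟨a, b, ha, hb, hs, hq, hV⟩ := exists_prod_le_mul_sq hx hy hz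
    have h := hpair a b ha hb
    rw [hAB, hs, hq] at h
    exact h.trans (add_le_add_right (mul_le_mul_of_nonpos_left hV hB) _)
  rcases exists_mul_sq_le_prod_or hx hy hz with ⟨a, b, ha, hb, hs, hq, hV⟩ | ⟨u, v, hu, hv, hs, hq⟩
  · have h := hpair a b ha hb
    rw [hAB, hs, hq] at h
    exact h.trans (add_le_add_right (mul_le_mul_of_nonneg_left hV hB) _)
  · have h := hface u v hu hv
    rw [hAB, hs, hq, zero_mul, zero_mul, mul_zero, add_zero] at h
    exact add_nonneg h (by positivity)

lemma eval_face {f : Poly3} (hf : f ∈ symForms 3 5) (u v : ℝ) : eval ![0, u, v] f =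
    (u + v) * ((diag f).coeff 5 * (u - v) ^ 4
      + (3 * (diag f).coeff 5 + (diag f).coeff 4 / 2) * (u - v) ^ 2 * (u * v)
      + (diag f).coeff 0 / 2 * (u * v) ^ 2) := by
  obtain ⟨p₀, p₁, p₂, p₃, p₄, rfl⟩ := exists_eq_symQuintic hf
  rw [diag_symQuintic, coeff_quintic_five, coeff_quintic_four, coeff_quintic_zero, eval_symQuintic]
  simp only [Matrix.cons_val]
  ring

lemma eval_face_eq_edge {f : Poly3} (hf : f ∈ symForms 3 5) {u v w : ℝ}
    (hw : (u - v) ^ 2 = w * (u * v)) :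
    eval ![0, u, v] f = (u + v) * (u * v) ^ 2 * (edge (diag f)).eval w := by
  rw [eval_face hf, eval_edge, show (u - v) ^ 4 = ((u - v) ^ 2) ^ 2 by ring, hw]
  ring

lemma eval_pair_nonneg {f : Poly3} (hf : f ∈ symForms 3 5) (hF : HalfLineNonneg (diag f))
    {a b : ℝ} (ha : 0 ≤ a) (hb : 0 ≤ b) : 0 ≤ eval ![b, a, a] f := by
  have h5 := hF.coeff_nonneg (natDegree_diag_le hf)
  obtain ⟨p₀, p₁, p₂, p₃, p₄, rfl⟩ := exists_eq_symQuintic hf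
  rcases ha.eq_or_lt with rfl | ha
  · have hvertex : eval ![b, 0, 0] (symQuintic p₀ p₁ p₂ p₃ p₄) = p₀ * b ^ 5 := by
      rw [eval_symQuintic]
      simp only [Matrix.cons_val]
      ring
    rw [hvertex]
    rw [diag_symQuintic, coeff_quintic_five] at h5
    positivity
  · have hscale : eval ![b, a, a] (symQuintic p₀ p₁ p₂ p₃ p₄) =
        a ^ 5 * eval ![b / a, 1, 1] (symQuintic p₀ p₁ p₂ p₃ p₄) := by
      rw [eval_symQuintic, eval_symQuintic]
      simp only [Matrix.cons_val]
      field_simp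
    rw [hscale, ← eval_diag]
    exact mul_nonneg (by positivity) (hF _ (by positivity))

lemma eval_face_nonneg {f : Poly3} (hf : f ∈ symForms 3 5) (hF : HalfLineNonneg (diag f))
    (hE : HalfLineNonneg (edge (diag f))) {u v : ℝ} (hu : 0 ≤ u) (hv : 0 ≤ v) :
    0 ≤ eval ![0, u, v] f := by
  rcases (mul_nonneg hu hv).eq_or_lt with huv | huv
  · have h0 : 0 ≤ (diag f).coeff 5 := hF.coeff_nonneg (natDegree_diag_le hf)
    rw [eval_face hf, ← huv]
    simp only [mul_zero, ne_eq, OfNat.ofNat_ne_zero, not_false_eq_true, zero_pow, add_zero]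
    positivity
  · have hw : 0 ≤ (u - v) ^ 2 / (u * v) := by positivity
    rw [eval_face_eq_edge hf (div_mul_cancel₀ _ huv.ne').symm]
    exact mul_nonneg (by positivity) (hE _ hw)

lemma edge_nonneg_of_face_nonneg {f : Poly3} (hf : f ∈ symForms 3 5)
    (hface : ∀ u v : ℝ, 0 ≤ u → 0 ≤ v → 0 ≤ eval ![0, u, v] f) :
    HalfLineNonneg (edge (diag f)) := fun w hw => by
  have hle : √w ≤ √(w + 4) := Real.sqrt_le_sqrt (by linarith)
  have hsq := Real.sq_sqrt hw
  have hsq4 := Real.sq_sqrt (show 0 ≤ w + 4 by linarith)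
  have hpos : 0 < √(w + 4) := Real.sqrt_pos.2 (by linarith)
  have huv : (√(w + 4) + √w) * (√(w + 4) - √w) = 4 := by linear_combination hsq4 - hsq
  have h := hface (√(w + 4) + √w) (√(w + 4) - √w) (by positivity) (sub_nonneg.2 hle)
  rw [eval_face_eq_edge hf (w := w) (by linear_combination 4 * hsq - w * huv), huv] at h
  exact nonneg_of_mul_nonneg_right h (by linarith)

lemma mem_symPsdCone_iff {f : Poly3} (hf : f ∈ symForms 3 5) :
    f ∈ symPsdCone 3 5 ↔ diag f ∈ diagCone := by
  have orthant {x y z : ℝ} (hx : 0 ≤ x) (hy : 0 ≤ y) (hz : 0 ≤ z) : ∀ i, 0 ≤ ![x, y, z] i := by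
    simp [Fin.forall_fin_succ, hx, hy, hz]
  constructor
  · exact fun ⟨_, hpsd⟩ =>
      { natDegree_le := natDegree_diag_le hf
        balance_eq_zero := balance_diag hf
        nonneg := fun x hx => eval_diag x f ▸ hpsd _ (orthant hx zero_le_one zero_le_one)
        edge_nonneg := edge_nonneg_of_face_nonneg hf fun u v hu hv =>
          hpsd _ (orthant le_rfl hu hv) }
  · refine fun hF => ⟨hf, fun a ha => ?_⟩
    rw [← FinVec.etaExpand_eq a]
    exact eval_nonneg_of_boundary hf (fun _ _ => eval_pair_nonneg hf hF.nonneg)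
      (fun _ _ => eval_face_nonneg hf hF.nonneg hF.edge_nonneg) (ha 0) (ha 1) (ha 2)

lemma image_diag : diag '' symPsdCone 3 5 = diagCone := by
  ext F
  constructor
  · rintro ⟨f, hf, rfl⟩
    exact (mem_symPsdCone_iff hf.1).1 hf
  · intro hF
    obtain ⟨f, hf, rfl⟩ := exists_diag_eq hF.natDegree_le hF.balance_eq_zero
    exact ⟨f, (mem_symPsdCone_iff hf).2 hF, rfl⟩

lemma isExtremal_iff_diag {f : Poly3} (hf : f ∈ symForms 3 5) :
    IsExtremal (symPsdCone 3 5) f ↔ IsExtremal diagCone (diag f) := by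
  rw [← image_diag]
  exact (isExtremal_image_iff (φ := diag.toLinearMap) (fun g hg => hg.1) injOn_diag hf).symm

end Boundary

end SymQuintic

namespace SymQuintic

open Polynomial

/-! ### The listed generators -/

section Restrictions

lemma eval_diag_symQuintic (p₀ p₁ p₂ p₃ p₄ x : ℝ) :
    (diag (symQuintic p₀ p₁ p₂ p₃ p₄)).eval x =
      (x - 1) ^ 2 * (p₀ * ((x + 1) * (x ^ 2 + x + 2)) + 2 * p₁ * (x + 1) ^ 2
        + 2 * p₂ * (x + 1) + p₃ * x) + p₄ * (x * (2 * x + 1)) := by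
  rw [diag_symQuintic, eval_quintic]
  ring

lemma eval_twoRoots (t z a c x : ℝ) :
    (twoRoots t z a c).eval x = (x - t) ^ 2 * (x - z) ^ 2 * (a * x + c) := by
  simp only [twoRoots, eval_mul, eval_pow, eval_sub, eval_add, eval_X, eval_C]

lemma eval_rootAndZero (t a c x : ℝ) :
    (rootAndZero t a c).eval x = x * (x - t) ^ 2 * (a * x + c) := by
  simp only [rootAndZero, eval_mul, eval_pow, eval_sub, eval_add, eval_X, eval_C]

lemma eA_eq_symQuintic (t : ℝ) {u : ℝ} (hu : u ≠ 0) :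
    eA t u = symQuintic 1 (pA1 t u) (pA2 t u) (pA3 t u) (pA4 t u) := by
  rw [eA, if_neg hu, symQuintic, one_smul]

lemma eA_zero_eq_symQuintic (t : ℝ) :
    eA t 0 = symQuintic 0 ((5 * t + 1) ^ 2) ((t - 1) ^ 2 * (t ^ 2 - 12 * t - 1))
      (-(2 * (t ^ 4 + 36 * t ^ 3 + 34 * t ^ 2 + 60 * t + 13))) (24 * (t - 1) ^ 4) := by
  rw [eA, if_pos rfl, symQuintic]
  module

lemma eB_eq_symQuintic (t u : ℝ) : eB t u = symQuintic 1 (pB1 t (omega u)) (pB2 t (omega u))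
    (pB3 t (omega u)) (pB4 t (omega u)) := by
  rw [eB, symQuintic, one_smul]

lemma eC_eq_symQuintic (t : ℝ) : eC t = symQuintic 1 (-(t + 1)) t ((t + 1) ^ 2) 0 := by
  rw [eC, symQuintic]
  module

lemma eD_eq_symQuintic (t : ℝ) : eD t = symQuintic 0 1 (t ^ 2 - 1) (-(2 * (t + 1) ^ 2)) 0 := by
  rw [eD, symQuintic]
  module

lemma eDInf_eq_symQuintic : eDInf = symQuintic 0 0 1 (-2) 0 := by
  rw [eDInf, symQuintic]
  module

lemma eE_eq_symQuintic (t : ℝ) : eE t =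
    symQuintic 0 1 (-1) (-((4 * t ^ 2 + 5 * t + 3) / (t + 2))) ((t - 1) ^ 3 / (t + 2)) := by
  rw [eE, symQuintic]
  module

lemma eEInf_eq_symQuintic : eEInf = symQuintic 0 0 0 0 1 := by
  rw [eEInf, symQuintic]
  module

lemma U_mul_sub_eq_symQuintic : U * (S1 2 - S2 1 1) = symQuintic 0 0 0 1 0 := by
  rw [mul_sub, ← s3, symQuintic]
  module

lemma eB_mem (t u : ℝ) : eB t u ∈ symForms 3 5 := eB_eq_symQuintic t u ▸ symQuintic_mem ..

lemma eC_mem (t : ℝ) : eC t ∈ symForms 3 5 := eC_eq_symQuintic t ▸ symQuintic_mem ..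

lemma eD_mem (t : ℝ) : eD t ∈ symForms 3 5 := eD_eq_symQuintic t ▸ symQuintic_mem ..

lemma eE_mem (t : ℝ) : eE t ∈ symForms 3 5 := eE_eq_symQuintic t ▸ symQuintic_mem ..

lemma eA_mem (t u : ℝ) : eA t u ∈ symForms 3 5 := by
  rcases eq_or_ne u 0 with rfl | hu
  · exact eA_zero_eq_symQuintic t ▸ symQuintic_mem ..
  · exact eA_eq_symQuintic t hu ▸ symQuintic_mem ..

lemma mem_symForms_of_mem_generators {e : Poly3} (he : e ∈ generators) : e ∈ symForms 3 5 := by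
  rcases he with
    ((((⟨t, u, -, -, -, -, rfl⟩ | ⟨t, u, -, -, -, rfl⟩) | ⟨t, -, -, rfl⟩) |
      ⟨t, -, rfl⟩ | rfl) | ⟨t, -, rfl⟩ | rfl) | rfl
  · exact eA_mem t u
  · exact eB_mem t u
  · exact eC_mem t
  · exact eD_mem t
  · exact eDInf_eq_symQuintic ▸ symQuintic_mem ..
  · exact eE_mem t
  · exact eEInf_eq_symQuintic ▸ symQuintic_mem ..
  · exact U_mul_sub_eq_symQuintic ▸ symQuintic_mem ..

lemma diag_eA {t u : ℝ} (ht : 0 ≤ t) (hu : u ≠ 0) :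
    diag (eA t u) = twoRoots t (muZ t u) 1
      (2 * (t + 2) * (9 * (t - 1) ^ 2 - u) / ((5 * t + 1) * u)) := by
  refine Polynomial.funext fun x => ?_
  rw [eA_eq_symQuintic t hu, eval_diag_symQuintic, eval_twoRoots, pA1, pA2, pA3, pA4, muZ]
  field_simp
  ring

lemma diag_eA_zero {t : ℝ} (ht : 0 ≤ t) :
    diag (eA t 0) = twoRoots t (muZ t 0) 0 (2 * (5 * t + 1) ^ 2) := by
  refine Polynomial.funext fun x => ?_
  rw [eA_zero_eq_symQuintic, eval_diag_symQuintic, eval_twoRoots, muZ]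
  field_simp
  ring

lemma diag_eB {t : ℝ} (ht : 0 < t) (u : ℝ) : diag (eB t u) = edgeRoot t (omega u / t) := by
  refine Polynomial.funext fun x => ?_
  rw [eB_eq_symQuintic, eval_diag_symQuintic]
  generalize omega u = w
  simp only [edgeRoot, edgeGap, pB1, pB2, pB3, pB4, eval_mul, eval_pow, eval_sub, eval_add, eval_X,
    eval_C]
  field_simp
  ring

lemma diag_eC (t : ℝ) : diag (eC t) = twoRoots 1 t 1 0 := by
  refine Polynomial.funext fun x => ?_
  rw [eC_eq_symQuintic, eval_diag_symQuintic, eval_twoRoots]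
  ring

lemma diag_eD (t : ℝ) : diag (eD t) = (2 : ℝ) • twoRoots 1 t 0 1 := by
  refine Polynomial.funext fun x => ?_
  rw [eD_eq_symQuintic, eval_diag_symQuintic, eval_smul, eval_twoRoots, smul_eq_mul]
  ring

lemma diag_eDInf : diag eDInf = (2 : ℝ) • (X - C 1) ^ 2 := by
  refine Polynomial.funext fun x => ?_
  rw [eDInf_eq_symQuintic, eval_diag_symQuintic]
  simp only [eval_smul, eval_pow, eval_sub, eval_X, eval_C, smul_eq_mul]
  ring

lemma diag_eE {t : ℝ} (ht : 0 ≤ t) : diag (eE t) = rootAndZero t 2 ((t - 7) / (t + 2)) := by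
  refine Polynomial.funext fun x => ?_
  rw [eE_eq_symQuintic, eval_diag_symQuintic, eval_rootAndZero]
  field_simp
  ring

lemma diag_eEInf : diag eEInf = X * (C 2 * X + C 1) := by
  refine Polynomial.funext fun x => ?_
  rw [eEInf_eq_symQuintic, eval_diag_symQuintic]
  simp only [eval_mul, eval_add, eval_X, eval_C]
  ring

lemma diag_U_mul_sub : diag (U * (S1 2 - S2 1 1)) = X * (X - C 1) ^ 2 := by
  refine Polynomial.funext fun x => ?_
  rw [U_mul_sub_eq_symQuintic, eval_diag_symQuintic]
  simp only [eval_mul, eval_pow, eval_sub, eval_X, eval_C]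
  ring

end Restrictions

section Parameters

variable {t u w z : ℝ}

lemma two_le_muR (ht : 2 ≤ t) : 2 ≤ muR t := by
  have h : t ≤ √((t - 1) * (t + 2)) := Real.le_sqrt_of_sq_le (by nlinarith)
  rw [muR]
  nlinarith

lemma muB_mem_Ioc (ht : 2 ≤ t) : muB t ∈ Set.Ioc 0 1 := by
  have hR := two_le_muR ht
  have hlt : √(muR t ^ 2 - 4) < muR t := (Real.sqrt_lt' (by linarith)).2 (by linarith)
  have hle : muR t - 2 ≤ √(muR t ^ 2 - 4) := Real.le_sqrt_of_sq_le (by nlinarith)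
  constructor <;> rw [muB] <;> linarith

lemma muB_sq (ht : 2 ≤ t) : muB t ^ 2 = muR t * muB t - 1 := by
  have hsq := Real.sq_sqrt (show 0 ≤ muR t ^ 2 - 4 by nlinarith [two_le_muR ht])
  rw [muB]
  linear_combination hsq / 4

lemma omega_eq (hu : 0 < u) : omega u = (1 - u) ^ 2 / u := by
  rw [omega]
  field_simp
  ring

lemma omega_nonneg (hu : 0 < u) : 0 ≤ omega u := by
  rw [omega_eq hu]
  positivity

lemma omega_pos (hu : 0 < u) (hu1 : u < 1) : 0 < omega u := by
  have := sub_pos.2 hu1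
  rw [omega_eq hu]
  positivity

lemma exists_omega_eq (hw : 0 ≤ w) : ∃ u : ℝ, 0 < u ∧ u ≤ 1 ∧ omega u = w := by
  have hsq := Real.sq_sqrt (show 0 ≤ w ^ 2 + 4 * w by positivity)
  have hlt : √(w ^ 2 + 4 * w) < w + 2 := (Real.sqrt_lt' (by linarith)).2 (by linarith)
  have hle : w ≤ √(w ^ 2 + 4 * w) := Real.le_sqrt_of_sq_le (by linarith)
  have hu : 0 < (w + 2 - √(w ^ 2 + 4 * w)) / 2 := by linarith
  refine ⟨(w + 2 - √(w ^ 2 + 4 * w)) / 2, hu, by linarith, ?_⟩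
  rw [omega_eq hu, div_eq_iff hu.ne']
  linear_combination hsq / 4

lemma muB_le_iff_omega_le (ht : 2 ≤ t) (hu : 0 < u) (hu1 : u ≤ 1) :
    muB t ≤ u ↔ omega u ≤ muR t - 2 := by
  obtain ⟨hB, hB1⟩ := muB_mem_Ioc ht
  have factor : (muR t - 2 - omega u) * (u * muB t) = (u - muB t) * (1 - u * muB t) := by
    rw [omega]
    field_simp
    linear_combination -u * muB_sq ht
  have hpos : 0 < u * muB t := by positivity
  rcases hB1.eq_or_lt with h1 | h1
  · rw [h1, mul_one] at factor
    constructor <;> intro h <;> nlinarith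
  · have hpos' : 0 < 1 - u * muB t := by nlinarith
    rw [← sub_nonneg, ← mul_nonneg_iff_of_pos_right hpos', ← factor,
      mul_nonneg_iff_of_pos_right hpos, sub_nonneg]

lemma le_muR_sub_two_iff (ht : 2 ≤ t) (hw : 0 ≤ w) :
    w ≤ muR t - 2 ↔ 0 ≤ edgeGap t (w / t) := by
  have ht0 : 0 < t := by linarith
  have hgap : edgeGap t (w / t) = (t - 1) * (t + 2) - ((w + t ^ 2) / t) ^ 2 := by
    rw [edgeGap]
    field_simp
    ring
  rw [hgap, sub_nonneg, ← Real.le_sqrt' (by positivity), div_le_iff₀ ht0, muR]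
  constructor <;> intro h <;> linarith

lemma muB_le_iff_edgeGap_nonneg (ht : 2 ≤ t) (hu : 0 < u) (hu1 : u ≤ 1) :
    muB t ≤ u ↔ 0 ≤ edgeGap t (omega u / t) := by
  rw [muB_le_iff_omega_le ht hu hu1, le_muR_sub_two_iff ht (omega_nonneg hu)]

lemma muZ_nonneg (ht : 0 ≤ t) (hH : u ≤ muH t) : 0 ≤ muZ t u := by
  rw [muH] at hH
  exact div_nonneg (by linarith) (by positivity)

lemma muZ_pos (ht : 0 ≤ t) (hH : u < muH t) : 0 < muZ t u := by
  rw [muH] at hH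
  exact div_pos (by linarith) (by positivity)

lemma muZ_ne_one (ht : 0 ≤ t) (ht1 : t ≠ 1) (hu : 0 ≤ u) (hL : u ≤ muL t) : muZ t u ≠ 1 := by
  intro h
  rw [muZ, div_eq_one_iff_eq (by positivity)] at h
  rw [muL] at hL
  rcases ht1.lt_or_gt with h1 | h1 <;> nlinarith

/-- The parameter `u` with `muZ t u = z`. -/
def muZInv (t z : ℝ) : ℝ := (t + 2) * (7 - t - z - 5 * t * z)

lemma muZ_muZInv (ht : 0 ≤ t) (z : ℝ) : muZ t (muZInv t z) = z := by
  rw [muZ, muZInv]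
  field_simp
  ring

lemma muL_sub_muZInv (t z : ℝ) :
    9 * (t - 1) ^ 2 - muZInv t z = (5 * t + 1) * (2 * t + 2 * z + t * z - 5) := by
  rw [muZInv]
  ring

lemma muZInv_le_muA (ht : 0 ≤ t) (hz : 0 ≤ z) (h : 0 ≤ 2 * t + 2 * z + t * z - 5) :
    muZInv t z ≤ muA t := by
  refine le_min ?_ ?_
  · rw [muL, ← sub_nonneg, muL_sub_muZInv]
    positivity
  · have : 0 ≤ (t + 2) * (z + 5 * t * z) := by positivity
    rw [muH, muZInv]
    linarith

end Parameters

section Generated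

variable {t u a c z : ℝ}

lemma smul_twoRoots (r t z a c : ℝ) : r • twoRoots t z a c = twoRoots t z (r * a) (r * c) :=
  Polynomial.funext fun x => by
    rw [eval_smul, eval_twoRoots, eval_twoRoots, smul_eq_mul]
    ring

lemma smul_rootAndZero (r t a c : ℝ) : r • rootAndZero t a c = rootAndZero t (r * a) (r * c) :=
  Polynomial.funext fun x => by
    rw [eval_smul, eval_rootAndZero, eval_rootAndZero, smul_eq_mul]
    ring

lemma exists_diag_eA_eq_twoRoots (ht : 0 ≤ t) (hu : 0 ≤ u) (hL : u ≤ muL t) :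
    ∃ a c : ℝ, 0 ≤ a ∧ 0 ≤ c ∧ 0 < a + c ∧ diag (eA t u) = twoRoots t (muZ t u) a c := by
  rcases hu.eq_or_lt with rfl | hu
  · exact ⟨0, _, le_rfl, by positivity, by positivity, diag_eA_zero ht⟩
  · have : 0 ≤ 9 * (t - 1) ^ 2 - u := sub_nonneg.2 hL
    exact ⟨1, _, zero_le_one, by positivity, by positivity, diag_eA ht hu.ne'⟩

lemma diag_eA_one_zero : diag (eA 1 0) = (72 : ℝ) • twoRoots 1 1 0 1 := by
  rw [diag_eA_zero zero_le_one, smul_twoRoots]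
  norm_num [muZ]

lemma isGenerated_diag_eA (ht : 0 ≤ t) (hu : 0 ≤ u) (hA : u ≤ muA t) :
    IsGenerated (diag (eA t u)) := by
  have hL : u ≤ muL t := hA.trans (min_le_left _ _)
  rcases eq_or_ne t 1 with rfl | ht1
  · obtain rfl : u = 0 := le_antisymm (by simpa [muL] using hL) hu
    exact ⟨72, by norm_num, _, .twoRoots_one_C zero_le_one, diag_eA_one_zero⟩
  · obtain ⟨a, c, ha, hc, hac, hdiag⟩ := exists_diag_eA_eq_twoRoots ht hu hL
    have hb := balance_diag (eA_mem t u)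
    rw [hdiag] at hb ⊢
    exact (IsRayGenerator.twoRoots ht (muZ_nonneg ht (hA.trans (min_le_right _ _))) ht1
      (muZ_ne_one ht ht1 hu hL) ha hc hac hb).isGenerated

lemma isGenerated_diag_eB (ht : 2 ≤ t) (hB : muB t ≤ u) (hu1 : u ≤ 1) :
    IsGenerated (diag (eB t u)) := by
  have ht0 : 0 < t := by linarith
  have hu := (muB_mem_Ioc ht).1.trans_le hB
  rw [diag_eB ht0]
  exact (IsRayGenerator.edgeRoot ht (div_nonneg (omega_nonneg hu) ht0.le)
    ((muB_le_iff_edgeGap_nonneg ht hu hu1).1 hB)).isGenerated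

lemma isGenerated_diag_eE (ht : 7 ≤ t) : IsGenerated (diag (eE t)) := by
  have ht0 : 0 ≤ t := by linarith
  have hc : 0 ≤ (t - 7) / (t + 2) := div_nonneg (by linarith) (by linarith)
  have hb := balance_diag (eE_mem t)
  rw [diag_eE ht0] at hb ⊢
  exact (IsRayGenerator.rootAndZero ht0 (by linarith) two_pos.le hc (by positivity)
    hb).isGenerated

lemma isGenerated_diag_of_mem_generators {e : Poly3} (he : e ∈ generators) :
    IsGenerated (diag e) := by
  rcases he with
    ((((⟨t, u, ht, -, hu, hA, rfl⟩ | ⟨t, u, ht, hB, hu, rfl⟩) | ⟨t, ht, ht2, rfl⟩) |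
      ⟨t, ht, rfl⟩ | rfl) | ⟨t, ht, rfl⟩ | rfl) | rfl
  · exact isGenerated_diag_eA ht hu hA
  · exact isGenerated_diag_eB ht hB hu
  · exact diag_eC t ▸ (IsRayGenerator.twoRoots_one_X ht ht2).isGenerated
  · exact ⟨2, two_pos, _, .twoRoots_one_C ht, diag_eD t⟩
  · exact ⟨2, two_pos, _, .sq_one, diag_eDInf⟩
  · exact isGenerated_diag_eE ht
  · exact diag_eEInf ▸ IsRayGenerator.X_mul_linear.isGenerated
  · exact diag_U_mul_sub ▸ IsRayGenerator.X_mul_sq_one.isGenerated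

lemma isExtremal_of_mem_generators {e : Poly3} (he : e ∈ generators) :
    IsExtremal (symPsdCone 3 5) e :=
  (isExtremal_iff_diag (mem_symForms_of_mem_generators he)).2
    (isExtremal_diagCone_iff.2 (isGenerated_diag_of_mem_generators he))

lemma eA_mem_generators (ht : 0 ≤ t) (ht7 : t ≤ 7) (hu : 0 ≤ u) (hA : u ≤ muA t) :
    eA t u ∈ generators :=
  Or.inl (Or.inl (Or.inl (Or.inl (Or.inl ⟨t, u, ht, ht7, hu, hA, rfl⟩))))

lemma eB_mem_generators (ht : 2 ≤ t) (hB : muB t ≤ u) (hu : u ≤ 1) : eB t u ∈ generators :=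
  Or.inl (Or.inl (Or.inl (Or.inl (Or.inr ⟨t, u, ht, hB, hu, rfl⟩))))

lemma eC_mem_generators (ht : 0 ≤ t) (ht2 : t ≤ 2) : eC t ∈ generators :=
  Or.inl (Or.inl (Or.inl (Or.inr ⟨t, ht, ht2, rfl⟩)))

lemma eD_mem_generators (ht : 0 ≤ t) : eD t ∈ generators :=
  Or.inl (Or.inl (Or.inr (Or.inl ⟨t, ht, rfl⟩)))

lemma eDInf_mem_generators : eDInf ∈ generators := Or.inl (Or.inl (Or.inr (Or.inr rfl)))

lemma eE_mem_generators (ht : 7 ≤ t) : eE t ∈ generators := Or.inl (Or.inr (Or.inl ⟨t, ht, rfl⟩))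

lemma eEInf_mem_generators : eEInf ∈ generators := Or.inl (Or.inr (Or.inr rfl))

lemma U_mul_sub_mem_generators : U * (S1 2 - S2 1 1) ∈ generators := Or.inr rfl

lemma twoRoots_zero_eq_smul_diag_eA (ht : 0 ≤ t) (hz : muZInv t z = 0) (c : ℝ) :
    twoRoots t z 0 c = (c / (2 * (5 * t + 1) ^ 2)) • diag (eA t (muZInv t z)) := by
  have hmuZ := muZ_muZInv ht z
  rw [hz] at hmuZ ⊢
  rw [diag_eA_zero ht, hmuZ, smul_twoRoots, mul_zero, div_mul_cancel₀ _ (by positivity)]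

lemma twoRoots_eq_smul_diag_eA (ht : 0 ≤ t) (hz : muZInv t z ≠ 0)
    (hc : c * (7 - t - z - 5 * t * z) = 2 * a * (2 * t + 2 * z + t * z - 5)) :
    twoRoots t z a c = a • diag (eA t (muZInv t z)) := by
  have hc' : c = a * (2 * (t + 2) * (9 * (t - 1) ^ 2 - muZInv t z) /
      ((5 * t + 1) * muZInv t z)) := by
    rw [muL_sub_muZInv, ← mul_div_assoc, eq_div_iff (mul_ne_zero (by positivity) hz), muZInv]
    linear_combination (5 * t + 1) * (t + 2) * hc
  rw [diag_eA ht hz, muZ_muZInv ht, smul_twoRoots, mul_one, ← hc']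

lemma exists_twoRoots_eq_smul_diag (ht : 0 ≤ t) (hz : 0 ≤ z) (ht1 : t ≠ 1) (hz1 : z ≠ 1)
    (ha : 0 ≤ a) (hc : 0 ≤ c) (hac : 0 < a + c) (hb : balance (twoRoots t z a c) = 0) :
    ∃ e ∈ generators, ∃ r : ℝ, 0 < r ∧ twoRoots t z a c = r • diag e := by
  rw [balance_twoRoots_eq_zero_iff ht1 hz1] at hb
  have hsign := one_sub_mul_one_sub_neg ht ht1 hz1 ha hc hac hb
  have hgap : 3 * a * -((1 - t) * (1 - z)) = (a + c) * (7 - t - z - 5 * t * z) := by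
    linear_combination -hb
  have hcoef : 3 * c * -((1 - t) * (1 - z)) = 2 * (a + c) * (2 * t + 2 * z + t * z - 5) := by
    linear_combination hb
  have hneg : 0 < -((1 - t) * (1 - z)) := neg_pos.2 hsign
  have h1 : 0 ≤ 7 - t - z - 5 * t * z :=
    nonneg_of_mul_nonneg_right (hgap ▸ by positivity) hac
  have h2 : 0 ≤ 2 * t + 2 * z + t * z - 5 :=
    nonneg_of_mul_nonneg_right (hcoef ▸ by positivity) (by positivity : 0 < 2 * (a + c))
  have ht7 : t ≤ 7 := by nlinarith [mul_nonneg ht hz]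
  refine ⟨eA t (muZInv t z), eA_mem_generators ht ht7 (mul_nonneg (by positivity) h1)
    (muZInv_le_muA ht hz h2), ?_⟩
  rcases ha.eq_or_lt with rfl | ha
  · have hzero : 7 - t - z - 5 * t * z = 0 := by
      rw [mul_zero, zero_mul, zero_add] at hgap
      exact (mul_eq_zero.1 hgap.symm).resolve_left (by linarith)
    refine ⟨c / (2 * (5 * t + 1) ^ 2), div_pos (by linarith) (by positivity),
      twoRoots_zero_eq_smul_diag_eA ht (by rw [muZInv, hzero, mul_zero]) c⟩
  · have hpos : 0 < 7 - t - z - 5 * t * z :=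
      pos_of_mul_pos_right (hgap ▸ by positivity) hac.le
    exact ⟨a, ha, twoRoots_eq_smul_diag_eA ht (mul_pos (by positivity) hpos).ne'
      (by linear_combination hb)⟩

lemma exists_rootAndZero_eq_smul_diag (ht : 0 ≤ t) (ht1 : t ≠ 1) (ha : 0 ≤ a) (hc : 0 ≤ c)
    (hac : 0 < a + c) (hb : balance (rootAndZero t a c) = 0) :
    ∃ e ∈ generators, ∃ r : ℝ, 0 < r ∧ rootAndZero t a c = r • diag e := by
  rw [balance_rootAndZero] at hb
  have hca : (2 * t + 4) * c = (t - 7) * a := by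
    linear_combination (mul_eq_zero.1 hb).resolve_left (sub_ne_zero.2 ht1.symm)
  have ha0 : 0 < a := by
    refine ha.lt_of_ne' fun h => ?_
    rw [h, mul_zero] at hca
    linarith [(mul_eq_zero.1 hca).resolve_left (by positivity)]
  have ht7 : 7 ≤ t := by
    have : 0 ≤ (t - 7) * a := hca ▸ by positivity
    linarith [nonneg_of_mul_nonneg_left this ha0]
  refine ⟨eE t, eE_mem_generators ht7, a / 2, by positivity, ?_⟩
  have hc' : c = a / 2 * ((t - 7) / (t + 2)) := by
    field_simp
    linear_combination hca
  rw [diag_eE ht, smul_rootAndZero, div_mul_cancel₀ _ two_ne_zero, ← hc']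

lemma exists_edgeRoot_eq_diag {v : ℝ} (ht : 2 ≤ t) (hv : 0 ≤ v) (hn : 0 ≤ edgeGap t v) :
    ∃ e ∈ generators, edgeRoot t v = diag e := by
  have ht0 : 0 < t := by linarith
  obtain ⟨u, hu, hu1, hw⟩ := exists_omega_eq (mul_nonneg ht0.le hv)
  have hv' : omega u / t = v := by rw [hw, mul_div_cancel_left₀ _ ht0.ne']
  refine ⟨eB t u, eB_mem_generators ht ?_ hu1, by rw [diag_eB ht0, hv']⟩
  rwa [muB_le_iff_edgeGap_nonneg ht hu hu1, hv']

lemma exists_generator_of_isRayGenerator {G : ℝ[X]} (hG : IsRayGenerator G) :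
    ∃ e ∈ generators, ∃ r : ℝ, 0 < r ∧ G = r • diag e := by
  cases hG with
  | sq_one =>
    exact ⟨eDInf, eDInf_mem_generators, 1 / 2, by norm_num, by rw [diag_eDInf]; module⟩
  | X_mul_sq_one =>
    exact ⟨_, U_mul_sub_mem_generators, 1, one_pos, by rw [diag_U_mul_sub, one_smul]⟩
  | X_mul_linear => exact ⟨eEInf, eEInf_mem_generators, 1, one_pos, by rw [diag_eEInf, one_smul]⟩
  | rootAndZero ht ht1 ha hc hac hb => exact exists_rootAndZero_eq_smul_diag ht ht1 ha hc hac hb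
  | @twoRoots_one_X t ht ht2 =>
    exact ⟨eC t, eC_mem_generators ht ht2, 1, one_pos, by rw [diag_eC, one_smul]⟩
  | @twoRoots_one_C t ht =>
    exact ⟨eD t, eD_mem_generators ht, 1 / 2, by norm_num, by rw [diag_eD]; module⟩
  | twoRoots ht hz ht1 hz1 ha hc hac hb =>
    exact exists_twoRoots_eq_smul_diag ht hz ht1 hz1 ha hc hac hb
  | edgeRoot ht hv hn =>
    obtain ⟨e, he, hdiag⟩ := exists_edgeRoot_eq_diag ht hv hn
    exact ⟨e, he, 1, one_pos, by rw [hdiag, one_smul]⟩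

theorem isExtremal_iff_exists_generator (f : Poly3) :
    IsExtremal (symPsdCone 3 5) f ↔ ∃ e ∈ generators, ∃ c : ℝ, 0 < c ∧ f = c • e := by
  constructor
  · intro hf
    have hmem : f ∈ symForms 3 5 := hf.1.1
    obtain ⟨c, hc, G, hG, hfG⟩ := isExtremal_diagCone_iff.1 ((isExtremal_iff_diag hmem).1 hf)
    obtain ⟨e, he, r, hr, rfl⟩ := exists_generator_of_isRayGenerator hG
    refine ⟨e, he, c * r, mul_pos hc hr, injOn_diag hmem
      (Submodule.smul_mem _ _ (mem_symForms_of_mem_generators he)) ?_⟩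
    rw [hfG, map_smul, smul_smul]
  · rintro ⟨e, he, c, hc, rfl⟩
    have hmem := mem_symForms_of_mem_generators he
    rw [isExtremal_iff_diag (Submodule.smul_mem _ c hmem), map_smul]
    exact ((isExtremal_iff_diag hmem).1 (isExtremal_of_mem_generators he)).smul
      (fun c hc G hG => smul_mem_diagCone hc hG) hc

end Generated

section Dimension

lemma linearIndependent_basis : LinearIndependent ℝ ![s0, s1, s2, s3, s4] := by
  refine Fintype.linearIndependent_iff.2 fun g hg => ?_
  have hzero : diag (symQuintic (g 0) (g 1) (g 2) (g 3) (g 4)) =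
      diag (symQuintic 0 0 0 0 0) := by
    rw [Fin.sum_univ_five] at hg
    exact congrArg diag (hg.trans (by simp only [symQuintic, zero_smul, add_zero]))
  rw [diag_symQuintic, diag_symQuintic, quintic_inj] at hzero
  obtain ⟨h5, h4, h3, h2, h1, -⟩ := hzero
  have hg1 : g 1 = 0 := by linarith
  have hg2 : g 2 = 0 := by linarith
  have hg3 : g 3 = 0 := by linarith
  have hg4 : g 4 = 0 := by linarith
  intro i
  fin_cases i <;> assumption

lemma span_basis : Submodule.span ℝ (Set.range ![s0, s1, s2, s3, s4]) = symForms 3 5 := by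
  refine le_antisymm (Submodule.span_le.2 (Set.range_subset_iff.2 fun i => ?_)) fun f hf => ?_
  · fin_cases i
    exacts [s0_mem, s1_mem, s2_mem, s3_mem, s4_mem]
  · obtain ⟨p₀, p₁, p₂, p₃, p₄, rfl⟩ := exists_eq_symQuintic hf
    have smul_mem : ∀ (a : ℝ) (i : Fin 5), a • ![s0, s1, s2, s3, s4] i ∈
        Submodule.span ℝ (Set.range ![s0, s1, s2, s3, s4]) := fun a i =>
      Submodule.smul_mem _ a (Submodule.subset_span ⟨i, rfl⟩)
    exact add_mem (add_mem (add_mem (add_mem (smul_mem p₀ 0) (smul_mem p₁ 1)) (smul_mem p₂ 2))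
      (smul_mem p₃ 3)) (smul_mem p₄ 4)

lemma span_symPsdCone : Submodule.span ℝ (symPsdCone 3 5) = symForms 3 5 := by
  refine le_antisymm (Submodule.span_le.2 fun f hf => hf.1) ?_
  have mem_span : ∀ e ∈ generators, e ∈ Submodule.span ℝ (symPsdCone 3 5) := fun e he =>
    Submodule.subset_span (isExtremal_of_mem_generators he).1
  have h4 : s4 ∈ Submodule.span ℝ (symPsdCone 3 5) := mem_span _ eEInf_mem_generators
  have h3 : s3 ∈ Submodule.span ℝ (symPsdCone 3 5) := by
    rw [s3, ← mul_sub]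
    exact mem_span _ U_mul_sub_mem_generators
  have h2 : s2 ∈ Submodule.span ℝ (symPsdCone 3 5) := by
    have h : s2 = eDInf + (2 : ℝ) • s3 := by rw [eDInf, sub_add_cancel]
    exact h ▸ add_mem (mem_span _ eDInf_mem_generators) (Submodule.smul_mem _ _ h3)
  have h1 : s1 ∈ Submodule.span ℝ (symPsdCone 3 5) := by
    have h : s1 = eD 1 + (8 : ℝ) • s3 := by rw [eD]; module
    exact h ▸ add_mem (mem_span _ (eD_mem_generators zero_le_one)) (Submodule.smul_mem _ _ h3)
  have h0 : s0 ∈ Submodule.span ℝ (symPsdCone 3 5) := by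
    have h : s0 = eC 0 + s1 - s3 := by rw [eC]; module
    exact h ▸ sub_mem (add_mem (mem_span _ (eC_mem_generators le_rfl zero_le_two)) h1) h3
  rw [← span_basis]
  refine Submodule.span_le.2 (Set.range_subset_iff.2 fun i => ?_)
  fin_cases i
  exacts [h0, h1, h2, h3, h4]

theorem finrank_span_symPsdCone : Module.finrank ℝ (Submodule.span ℝ (symPsdCone 3 5)) = 5 := by
  rw [span_symPsdCone, ← span_basis, finrank_span_eq_card linearIndependent_basis, Fintype.card_fin]

end Dimension

section EqualityConditions

variable {t u : ℝ}

lemma isCharacterizedIn_of_diag {e : Poly3} (he : e ∈ generators) {cond : Poly3 → Prop}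
    (hcond : ∀ α : ℝ, cond (α • e))
    (hdiag : ∀ f ∈ symForms 3 5, diag f ∈ diagCone → cond f → ∃ α : ℝ, diag f = α • diag e) :
    IsCharacterizedIn (symPsdCone 3 5) e cond := by
  obtain ⟨heD, he0, -⟩ := isExtremal_diagCone_iff.2 (isGenerated_diag_of_mem_generators he)
  refine fun f hf => ⟨fun hc => ?_, fun ⟨α, _, hα⟩ => hα ▸ hcond α⟩
  have hfD := (mem_symPsdCone_iff hf.1).1 hf
  obtain ⟨α, hα⟩ := hdiag f hf.1 hfD hc
  exact ⟨α, nonneg_of_smul_mem_diagCone heD he0 (hα ▸ hfD), injOn_diag hf.1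
    (Submodule.smul_mem _ α (mem_symForms_of_mem_generators he)) (by rw [hα, map_smul])⟩

lemma eval_vertex {f : Poly3} (hf : f ∈ symForms 3 5) :
    MvPolynomial.eval ![0, 0, 1] f = (diag f).coeff 5 := by
  rw [eval_face hf]
  ring

lemma eval_edge_point {f : Poly3} (hf : f ∈ symForms 3 5) (hu : u ≠ 0) :
    MvPolynomial.eval ![0, u, 1] f = (u + 1) * u ^ 2 * (edge (diag f)).eval (omega u) := by
  rw [eval_face_eq_edge hf (w := omega u), mul_one]
  rw [omega]
  field_simp
  ring

lemma eval_pderiv_symQuintic (p₀ p₁ p₂ p₃ p₄ u : ℝ) :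
    MvPolynomial.eval ![0, u, 1] (MvPolynomial.pderiv 1 (symQuintic p₀ p₁ p₂ p₃ p₄)) =
      5 * p₀ * u ^ 4 + p₁ * (4 * u ^ 3 + 1) + p₂ * (3 * u ^ 2 + 2 * u) := by
  simp only [symQuintic, s0, s1, s2, s3, s4, S1, S2, T2, U, MvPolynomial.smul_eq_C_mul]
  simp [MvPolynomial.pderiv_X]
  ring

lemma eval_pderiv_eB (t : ℝ) (hu : u ≠ 0) :
    MvPolynomial.eval ![0, u, 1] (MvPolynomial.pderiv 1 (eB t u)) = 0 := by
  rw [eB_eq_symQuintic, eval_pderiv_symQuintic, pB1, pB2, omega]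
  field_simp
  ring

theorem eA_characterized (ht : 0 < t) (ht7 : t ≤ 7) (ht1 : t ≠ 1) (hu : 0 ≤ u) (hA : u ≤ muA t)
    (huH : u ≠ muH t) :
    IsCharacterizedIn (symPsdCone 3 5) (eA t u) fun f =>
      MvPolynomial.eval ![t, 1, 1] f = 0 ∧ MvPolynomial.eval ![muZ t u, 1, 1] f = 0 := by
  obtain ⟨hL, hH⟩ := le_min_iff.1 hA
  obtain ⟨a, c, ha, hc, hac, hdiag⟩ := exists_diag_eA_eq_twoRoots ht.le hu hL
  have hz : 0 < muZ t u := muZ_pos ht.le (hH.lt_of_ne huH)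
  have hz1 : muZ t u ≠ 1 := muZ_ne_one ht.le ht1 hu hL
  have hb := balance_diag (eA_mem t u)
  rw [hdiag] at hb
  have hsign := one_sub_mul_one_sub_neg ht.le ht1 hz1 ha hc hac
    ((balance_twoRoots_eq_zero_iff ht1 hz1).1 hb)
  have htz : t ≠ muZ t u := fun h => hsign.not_ge (h ▸ mul_self_nonneg (1 - t))
  refine isCharacterizedIn_of_diag (eA_mem_generators ht.le ht7 hu hA) (fun α => ?_)
    fun f _ hfD hcond => ?_
  · simp only [← eval_diag, map_smul, hdiag, eval_smul, eval_twoRoots, smul_eq_mul]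
    constructor <;> ring
  · simp only [← eval_diag] at hcond
    exact hdiag ▸ exists_eq_smul_twoRoots ht hz ht1 hz1 htz hac hb hfD hcond.1 hcond.2

theorem eB_characterized (ht : 2 ≤ t) (hB : muB t ≤ u) (hu1 : u < 1) :
    IsCharacterizedIn (symPsdCone 3 5) (eB t u) fun f =>
      MvPolynomial.eval ![t, 1, 1] f = 0 ∧ MvPolynomial.eval ![0, u, 1] f = 0 ∧
        MvPolynomial.eval ![0, u, 1] (MvPolynomial.pderiv 1 f) = 0 := by
  have ht0 : 0 < t := by linarith
  have hu : 0 < u := (muB_mem_Ioc ht).1.trans_le hB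
  have hw : t * (omega u / t) = omega u := mul_div_cancel₀ _ ht0.ne'
  refine isCharacterizedIn_of_diag (eB_mem_generators ht hB hu1.le) (fun α => ⟨?_, ?_, ?_⟩)
    fun f hf hfD ⟨hroot, hzero, _⟩ => ?_
  · rw [MvPolynomial.smul_eval, ← eval_diag, diag_eB ht0, edgeRoot]
    simp
  · rw [MvPolynomial.smul_eval, eval_edge_point (eB_mem t u) hu.ne', diag_eB ht0, edge_edgeRoot,
      hw]
    simp
  · rw [Derivation.map_smul, MvPolynomial.smul_eval, eval_pderiv_eB t hu.ne', mul_zero]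
  · rw [← eval_diag] at hroot
    rw [eval_edge_point hf hu.ne'] at hzero
    rw [diag_eB ht0]
    exact exists_eq_smul_edgeRoot ht0 (by linarith) (div_pos (omega_pos hu hu1) ht0) hfD hroot
      (by rw [hw]; exact (mul_eq_zero.1 hzero).resolve_left (by positivity))

theorem eC_characterized (ht : 0 < t) (ht2 : t ≤ 2) (ht1 : t ≠ 1) :
    IsCharacterizedIn (symPsdCone 3 5) (eC t) fun f =>
      MvPolynomial.eval ![t, 1, 1] f = 0 ∧ MvPolynomial.eval ![1, 1, 1] f = 0 ∧
        MvPolynomial.eval ![0, 1, 1] f = 0 := by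
  simp only [← eval_diag]
  refine isCharacterizedIn_of_diag (eC_mem_generators ht.le ht2) (fun α => ?_)
    fun f _ hfD ⟨h1, h2, h3⟩ => ?_
  · simp [diag_eC, eval_twoRoots]
  · exact diag_eC t ▸ exists_eq_smul_twoRoots_one_X ht ht1 hfD h2 h1 h3

theorem eD_characterized (ht : 0 < t) (ht1 : t ≠ 1) :
    IsCharacterizedIn (symPsdCone 3 5) (eD t) fun f =>
      MvPolynomial.eval ![t, 1, 1] f = 0 ∧ MvPolynomial.eval ![1, 1, 1] f = 0 ∧
        MvPolynomial.eval ![0, 0, 1] f = 0 := by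
  simp only [← eval_diag]
  refine isCharacterizedIn_of_diag (eD_mem_generators ht.le) (fun α => ?_)
    fun f hf hfD ⟨h1, h2, h3⟩ => ?_
  · have h5 : (twoRoots 1 t 0 1).coeff 5 = 0 := by rw [twoRoots_eq_quintic, coeff_quintic_five]
    simp [eval_vertex (eD_mem t), diag_eD, eval_twoRoots, h5]
  · rw [eval_vertex hf] at h3
    obtain ⟨α, hα⟩ := exists_eq_smul_twoRoots_one_C ht ht1 hfD h2 h1 h3
    exact ⟨α / 2, by rw [diag_eD, hα]; module⟩

theorem eE_characterized (ht : 7 ≤ t) :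
    IsCharacterizedIn (symPsdCone 3 5) (eE t) fun f =>
      MvPolynomial.eval ![t, 1, 1] f = 0 ∧ MvPolynomial.eval ![0, 1, 1] f = 0 ∧
        MvPolynomial.eval ![0, 0, 1] f = 0 := by
  have ht0 : 0 < t := by linarith
  have hc : 0 ≤ (t - 7) / (t + 2) := div_nonneg (by linarith) (by linarith)
  have hb := balance_diag (eE_mem t)
  rw [diag_eE ht0.le] at hb
  simp only [← eval_diag]
  refine isCharacterizedIn_of_diag (eE_mem_generators ht) (fun α => ?_)
    fun f hf hfD ⟨h1, h2, h3⟩ => ?_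
  · have h5 : (rootAndZero t 2 ((t - 7) / (t + 2))).coeff 5 = 0 := by
      rw [rootAndZero_eq_quintic, coeff_quintic_five]
    simp [eval_vertex (eE_mem t), diag_eE ht0.le, eval_rootAndZero, h5]
  · rw [eval_vertex hf] at h3
    exact diag_eE ht0.le ▸
      exists_eq_smul_rootAndZero ht0 (by linarith) (add_pos_of_pos_of_nonneg two_pos hc) hb
        hfD h1 h2 h3

end EqualityConditions

end SymQuintic

end

open SymQuintic MvPolynomial in
theorem theorem1p4 :
    -- the cone is five dimensional
    Module.finrank ℝ (Submodule.span ℝ (symPsdCone 3 5)) = 5 ∧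
    -- the extremal elements are exactly the positive multiples of the listed polynomials
    (∀ f : Poly3, IsExtremal (symPsdCone 3 5) f ↔
      ∃ e ∈ generators, ∃ c : ℝ, 0 < c ∧ f = c • e) ∧
    -- the equality conditions that characterize the members of the five families
    (∀ t u : ℝ, 0 < t → t ≤ 7 → t ≠ 1 → 0 ≤ u → u ≤ muA t → u ≠ muH t →
      IsCharacterizedIn (symPsdCone 3 5) (eA t u) fun f =>
        eval ![t, 1, 1] f = 0 ∧ eval ![muZ t u, 1, 1] f = 0) ∧
    (∀ t u : ℝ, 2 ≤ t → muB t ≤ u → u < 1 →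
      IsCharacterizedIn (symPsdCone 3 5) (eB t u) fun f =>
        eval ![t, 1, 1] f = 0 ∧ eval ![0, u, 1] f = 0 ∧ eval ![0, u, 1] (pderiv 1 f) = 0) ∧
    (∀ t : ℝ, 0 < t → t ≤ 2 → t ≠ 1 →
      IsCharacterizedIn (symPsdCone 3 5) (eC t) fun f =>
        eval ![t, 1, 1] f = 0 ∧ eval ![1, 1, 1] f = 0 ∧ eval ![0, 1, 1] f = 0) ∧
    (∀ t : ℝ, 0 < t → t ≠ 1 →
      IsCharacterizedIn (symPsdCone 3 5) (eD t) fun f =>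
        eval ![t, 1, 1] f = 0 ∧ eval ![1, 1, 1] f = 0 ∧ eval ![0, 0, 1] f = 0) ∧
    (∀ t : ℝ, 7 ≤ t →
      IsCharacterizedIn (symPsdCone 3 5) (eE t) fun f =>
        eval ![t, 1, 1] f = 0 ∧ eval ![0, 1, 1] f = 0 ∧ eval ![0, 0, 1] f = 0) :=
  ⟨finrank_span_symPsdCone, isExtremal_iff_exists_generator,
    fun _ _ => eA_characterized, fun _ _ => eB_characterized, fun _ => eC_characterized,
    fun _ => eD_characterized, fun _ => eE_characterized⟩
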